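/- Let $\mathcal H$ be a separable complex Hilbert space with inner product $(x,y)$, and let $J$ be a bounded operator with $J=J^*$, $J^2=I$. Put $P_\pm=\tfrac12(I\pm J)$ and $\mathcal H^\pm=P_\pm\mathcal H$, so that $J=P_+-P_-$ and $\mathcal H=\mathcal H^+\oplus\mathcal H^-$, and let $[x,y]=(Jx,y)$; the pair $\{\mathcal H,J\}$ is a Krein space (the ranks of $P_\pm$ may be finite or infinite). A linear operator $T$ with domain $\mathcal D(T)$ in a Hilbert space is called dissipative if $\operatorname{Im}(Tx,x)\ge 0$ for all $x\in\mathcal D(T)$, and maximal dissipative if in addition it has no nontrivial dissipative extension; $T$ is called (maximal) dissipative in $\{\mathcal H,J\}$ if $JT$ is (maximal) dissipative in $\mathcal H$. A subspace $\mathcal L\subset\mathcal H$ is called nonnegative if $[x,x]\ge 0$ for all $x\in\mathcal L$, and maximal nonnegative if in addition it has no nontrivial nonnegative extension. Let $\mathbb C^+=\{\mu\in\mathbb C:\operatorname{Im}\mu>0\}$. Let $A$ be a linear operator which is dissipative in $\{\mathcal H,J\}$, and whose domain is dense in $\mathcal H$ and satisfies $\mathcal D(A)=\mathcal D^+\oplus\mathcal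 D^-$, where $\mathcal D^\pm=\mathcal D(A)\cap\mathcal H^\pm$. Write $$A=\begin{pmatrix}A_{11}&A_{12}\\A_{21}&A_{22}\end{pmatrix},\qquad A_{11}=P_+A|_{\mathcal D^+},\quad A_{12}=P_+A|_{\mathcal D^-},\quad A_{21}=P_-A|_{\mathcal D^+},\quad A_{22}=P_-A|_{\mathcal D^-},$$ for its matrix representation in $\mathcal H^+\oplus\mathcal H^-$. Assume: (i) $-A_{22}$ is maximal dissipative in $\mathcal H^-$; (ii) $F(\mu)=(A_{22}-\mu)^{-1}A_{21}$ admits a bounded closure for some $\mu\in\mathbb C^+$; (iii) $G(\mu)=A_{12}(A_{22}-\mu)^{-1}$ is compact for some $\mu\in\mathbb C^+$; (iv) $S(\mu)=A_{11}-A_{12}(A_{22}-\mu)^{-1}A_{21}$ admits a bounded closure for some $\mu\in\mathbb C^+$. Then every $\mu\in\mathbb C^+$ belongs to the resolvent set of $A_{22}$, and the properties in (ii), (iii) and (iv) hold for all $\mu\in\mathbb C^+$. Moreover, $A$ is closable, its closure $\overline A$ is maximal dissipative in $\{\mathcal H,J\}$, and there exists a closed maximal nonnegative subspace $\mathcal L\subset\mathcal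 D(\overline A)$ such that $\overline A\mathcal L\subset\mathcal L$, the restriction $\overline A|_{\mathcal L}:\mathcal L\to\mathcal L$ is a bounded operator, and its spectrum lies in the closed upper half-plane $\{z\in\mathbb C:\operatorname{Im}z\ge0\}$. -/

import Mathlib

namespace Krein

noncomputable section

/-! ### Partially defined (unbounded) linear operators -/

section Operators

variable {E F G : Type*}
  [NormedAddCommGroup E] [InnerProductSpace ℂ E]
  [NormedAddCommGroup F] [InnerProductSpace ℂ F]
  [NormedAddCommGroup G] [InnerProductSpace ℂ G]

/-- `T` is dissipative: `Im (T x, x) ≥ 0` for all `x` in the domain of `T`. The inner product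
`(u, v)`, linear in `u`, is `inner ℂ v u` in Mathlib. -/
def IsDissipative (T : E →ₗ.[ℂ] E) : Prop :=
  ∀ x : T.domain, 0 ≤ (inner ℂ (x : E) (T x)).im

/-- `T` is maximal dissipative: it is dissipative and has no nontrivial dissipative extension. -/
def IsMaximalDissipative (T : E →ₗ.[ℂ] E) : Prop :=
  IsDissipative T ∧ ∀ T' : E →ₗ.[ℂ] E, T ≤ T' → IsDissipative T' → T' = T

/-- The operator `T - μ`, on the domain of `T`. -/
def subScalar (T : E →ₗ.[ℂ] E) (μ : ℂ) : E →ₗ.[ℂ] E :=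
  (-(μ • (LinearMap.id : E →ₗ[ℂ] E))) +ᵥ T

/-- The product `g f` of two partially defined operators on its natural domain
`{x ∈ D(f) | f x ∈ D(g)}`. -/
def product (g : F →ₗ.[ℂ] G) (f : E →ₗ.[ℂ] F) : E →ₗ.[ℂ] G :=
  g.comp (f.domRestrict ((g.domain.comap f.toFun).map f.domain.subtype)) (by
    rintro ⟨x, hx⟩
    obtain ⟨⟨y, hy, hyx⟩, -⟩ := Submodule.mem_inf.mp hx
    have h := LinearPMap.domRestrict_apply (f := f) (x := ⟨x, hx⟩) (y := y) hyx.symm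
    exact (congrArg (fun z => z ∈ g.domain) h).mpr hy)

/-- `T` is closable and its closure is a bounded operator. -/
def HasBoundedClosure (T : E →ₗ.[ℂ] F) : Prop :=
  T.IsClosable ∧ ∃ C : ℝ, ∀ x : T.closure.domain, ‖T.closure x‖ ≤ C * ‖(x : E)‖

/-- `T` is an everywhere defined compact operator. -/
def IsCompactPMap (T : E →ₗ.[ℂ] F) : Prop :=
  ∃ B : E →L[ℂ] F, T = (B : E →ₗ[ℂ] F).toPMap ⊤ ∧ IsCompactOperator B

/-- `μ` belongs to the resolvent set of `T`: the operator `T - μ` is injective, and its inverse is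
an everywhere defined bounded operator. -/
def IsResolventPoint (T : E →ₗ.[ℂ] E) (μ : ℂ) : Prop :=
  LinearMap.ker (subScalar T μ).toFun = ⊥ ∧
    ∃ R : E →L[ℂ] E, (subScalar T μ).inverse = (R : E →ₗ[ℂ] E).toPMap ⊤

end Operators

/-! ### Krein spaces -/

section KreinSpace

variable {H : Type*} [NormedAddCommGroup H] [InnerProductSpace ℂ H]

/-- `J = J*` and `J² = I`, equivalently `J = P₊ - P₋` for complementary orthogonal projectors. -/
structure IsFundamentalSymmetry [CompleteSpace H] (J : H →L[ℂ] H) : Prop where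
  isSelfAdjoint : IsSelfAdjoint J
  mul_self : J * J = 1

/-- The projector `P₊ = (I + J) / 2`. -/
def projPlus (J : H →L[ℂ] H) : H →L[ℂ] H := (2⁻¹ : ℂ) • (1 + J)

/-- The projector `P₋ = (I - J) / 2`. -/
def projMinus (J : H →L[ℂ] H) : H →L[ℂ] H := (2⁻¹ : ℂ) • (1 - J)

/-- `H⁺`, the range of `P₊`. -/
def plusSpace (J : H →L[ℂ] H) : Submodule ℂ H := LinearMap.range (projPlus J : H →ₗ[ℂ] H)

/-- `H⁻`, the range of `P₋`. -/
def minusSpace (J : H →L[ℂ] H) : Submodule ℂ H := LinearMap.range (projMinus J : H →ₗ[ℂ] H)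

/-- `P₊` as a map onto `H⁺`. -/
def toPlus (J : H →L[ℂ] H) : H →ₗ[ℂ] plusSpace J := (projPlus J : H →ₗ[ℂ] H).rangeRestrict

/-- `P₋` as a map onto `H⁻`. -/
def toMinus (J : H →L[ℂ] H) : H →ₗ[ℂ] minusSpace J := (projMinus J : H →ₗ[ℂ] H).rangeRestrict

/-- `[x, x] = (J x, x) ≥ 0` for all `x ∈ L`. The number `(J x, x)` is real when `J = J*`. -/
def IsNonnegative (J : H →L[ℂ] H) (L : Submodule ℂ H) : Prop :=
  ∀ x ∈ L, 0 ≤ (inner ℂ x (J x)).re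

/-- `L` is nonnegative and has no nontrivial nonnegative extension. -/
def IsMaximalNonnegative (J : H →L[ℂ] H) (L : Submodule ℂ H) : Prop :=
  IsNonnegative J L ∧ ∀ L' : Submodule ℂ H, L ≤ L' → IsNonnegative J L' → L' = L

/-- `A` is dissipative in `{H, J}`: the operator `J A` is dissipative in `H`. -/
def IsDissipativeIn (J : H →L[ℂ] H) (A : H →ₗ.[ℂ] H) : Prop :=
  IsDissipative ((J : H →ₗ[ℂ] H).compPMap A)

/-- `A` is maximal dissipative in `{H, J}`: the operator `J A` is maximal dissipative in `H`. -/
def IsMaximalDissipativeIn (J : H →L[ℂ] H) (A : H →ₗ.[ℂ] H) : Prop :=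
  IsMaximalDissipative ((J : H →ₗ[ℂ] H).compPMap A)

/-- The operator `x ↦ p (A x)` from the subspace `U` to `V`, with domain `D(A) ∩ U`. -/
def block {V : Type*} [AddCommGroup V] [Module ℂ V]
    (A : H →ₗ.[ℂ] H) (U : Submodule ℂ H) (p : H →ₗ[ℂ] V) : U →ₗ.[ℂ] V where
  domain := A.domain.comap U.subtype
  toFun := (p ∘ₗ A.toFun) ∘ₗ
    ((U.subtype ∘ₗ (A.domain.comap U.subtype).subtype).codRestrict A.domain fun x => x.2)

variable (J : H →L[ℂ] H) (A : H →ₗ.[ℂ] H)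

/-- `A₁₁ : H⁺ → H⁺` with domain `D⁺`. -/
def block11 : plusSpace J →ₗ.[ℂ] plusSpace J := block A (plusSpace J) (toPlus J)

/-- `A₁₂ : H⁻ → H⁺` with domain `D⁻`. -/
def block12 : minusSpace J →ₗ.[ℂ] plusSpace J := block A (minusSpace J) (toPlus J)

/-- `A₂₁ : H⁺ → H⁻` with domain `D⁺`. -/
def block21 : plusSpace J →ₗ.[ℂ] minusSpace J := block A (plusSpace J) (toMinus J)

/-- `A₂₂ : H⁻ → H⁻` with domain `D⁻`. -/
def block22 : minusSpace J →ₗ.[ℂ] minusSpace J := block A (minusSpace J) (toMinus J)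

/-- `(A₂₂ - μ)⁻¹`. -/
def resolvent22 (μ : ℂ) : minusSpace J →ₗ.[ℂ] minusSpace J := (subScalar (block22 J A) μ).inverse

/-- `F(μ) = (A₂₂ - μ)⁻¹ A₂₁`. -/
def opF (μ : ℂ) : plusSpace J →ₗ.[ℂ] minusSpace J := product (resolvent22 J A μ) (block21 J A)

/-- `G(μ) = A₁₂ (A₂₂ - μ)⁻¹`. -/
def opG (μ : ℂ) : minusSpace J →ₗ.[ℂ] plusSpace J := product (block12 J A) (resolvent22 J A μ)

/-- `S(μ) = A₁₁ - A₁₂ (A₂₂ - μ)⁻¹ A₂₁`. -/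
def opS (μ : ℂ) : plusSpace J →ₗ.[ℂ] plusSpace J :=
  block11 J A - product (block12 J A) (opF J A μ)

end KreinSpace

end

end Krein

/-!
Write `R`, `F`, `G`, `S` for `(A₂₂ - μ)⁻¹` and the bounded extensions of `F(μ)`, `G(μ)`, `S(μ)`.

A densely defined maximal dissipative operator has no spectrum in the lower half-plane, so the
resolvent `R` exists for `μ ∈ ℂ⁺`, and the resolvent identity carries the boundedness and
compactness assumptions from one `μ` to all others (`exists_isSchurData`). Since `G(iη) = G₀ W(η)`
with `G₀` compact and `W(η) → 0` weakly, `‖G(iη)‖ → 0`, hence `‖S(iη)‖ = o(η)`, as `η → ∞`. The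
closure of `A` contains all pairs `u = a + (R z - F a) ↦ (S a + G z) + (z + μ (R z - F a))`, with
`a ∈ H⁺` and `z ∈ H⁻` arbitrary (`IsSchurData.mem_closure`). Solving for `a` and `z` shows that
`J Ā + iη` is onto, which gives maximality.

An invariant maximal nonnegative subspace is the graph of a contraction `K : H⁺ → H⁻`. For
`μ = iη`, dissipativity says that `(A + iηJ) u ↦ (A - iηJ) u` extends to a contraction `Θ` of
`H⁺ ⊕ H⁻`, given by bounded operators in terms of `R`, `F`, `G`, `S`. The graph of `K` is invariant
if `K` and `D` solve `D = Θ₁₁ + Θ₁₂ K D`, `K = Θ₂₁ + Θ₂₂ K D` with `1 - D` invertible, and the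
restriction of `A` is then similar to the Cayley transform `iη (1 + D) (1 - D)⁻¹`
(`IsDissipativeData.exists_angular`).

For `rΘ`, `0 < r < 1`, in place of `Θ`, the system is solved by the square summable states of a
semi-infinite chain of copies of `rΘ`; there `‖K‖ ≤ 1`, and the powers of `D` are bounded
(`exists_riccati_of_strict`). As `r → 1`, take a weak limit of the operators `K`. Compactness of
`Θ₁₂`, a multiple of `(S + iη)⁻¹ G`, makes the operators `D` converge strongly, and the equations
survive (`exists_riccati`); for large `η` one has `‖Θ₁₂‖ ≤ 1/4` and `‖Θ₁₁ + 1‖ ≤ 1/4`, so that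
`1 - D` is invertible. That the spectrum of `D` stays in the closed unit disc is a Hurwitz type
argument: by the analytic Fredholm theorem an eigenvalue of the limit outside the disc is isolated,
and the maximum principle for the resolvents of the approximations on a small circle around it
would produce an eigenvalue on the circle (`isUnit_one_sub_smul_of_tendsto`).
-/

namespace Krein

/-! ### The Riccati equation of a strict block contraction -/

section StrictContraction

open Filter Topology

variable {X Y : Type*}
  [NormedAddCommGroup X] [NormedAddCommGroup Y]

/-- Square summable sequences in the Hilbert space `X ⊕ Y`. -/
noncomputable abbrev SeqSpace (X Y : Type*) [NormedAddCommGroup X] [NormedAddCommGroup Y] :=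
  lp (fun _ : ℕ => WithLp 2 (X × Y)) 2

theorem SeqSpace.hasSum_sq (p : SeqSpace X Y) : HasSum (fun k => ‖p k‖ ^ 2) (‖p‖ ^ 2) := by
  have := lp.hasSum_norm (p := 2) (by norm_num) p
  simpa using this

/-- The input of the `k`-th cell of the chain: the `X`-component comes from the cell before it
(from `a` for the first cell), the `Y`-component from the cell after it. -/
def chainInput (a : X) (p : SeqSpace X Y) (k : ℕ) : X × Y :=
  (Nat.casesOn k a fun j => (p j).fst, (p (k + 1)).snd)

/-- The chain inputs carry the norm of `a` and of all components of `p` but the outgoing one. -/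
theorem hasSum_chainInput (a : X) (p : SeqSpace X Y) :
    HasSum (fun k => ‖(chainInput a p k).1‖ ^ 2 + ‖(chainInput a p k).2‖ ^ 2)
      (‖a‖ ^ 2 + ‖p‖ ^ 2 - ‖(p 0).snd‖ ^ 2) := by
  have hp := SeqSpace.hasSum_sq p
  simp only [WithLp.prod_norm_sq_eq_of_L2] at hp
  have h1 : Summable fun k => ‖(p k).fst‖ ^ 2 :=
    Summable.of_nonneg_of_le (fun _ => by positivity) (fun k => by
      have := sq_nonneg ‖(p k).snd‖; linarith) hp.summable
  have h2 : Summable fun k => ‖(p k).snd‖ ^ 2 :=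
    Summable.of_nonneg_of_le (fun _ => by positivity) (fun k => by
      have := sq_nonneg ‖(p k).fst‖; linarith) hp.summable
  have hs := (h1.hasSum.add h2.hasSum).unique hp
  have e1 : HasSum (fun k => ‖(chainInput a p k).1‖ ^ 2) (‖a‖ ^ 2 + ∑' k, ‖(p k).fst‖ ^ 2) := by
    rw [← hasSum_nat_add_iff' 1]
    simpa [chainInput] using h1.hasSum
  have e2 : HasSum (fun k => ‖(chainInput a p k).2‖ ^ 2)
      (∑' k, ‖(p k).snd‖ ^ 2 - ‖(p 0).snd‖ ^ 2) := by
    have := (hasSum_nat_add_iff' 1).mpr h2.hasSum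
    simpa [chainInput] using this
  convert! e1.add e2 using 1
  rw [← hs]; ring

theorem exists_shift (p : SeqSpace X Y) : ∃ p' : SeqSpace X Y, ∀ k, p' k = p (k + 1) := by
  refine ⟨⟨fun k => p (k + 1), ?_⟩, fun k => rfl⟩
  refine memℓp_gen ?_
  simp only [ENNReal.toReal_ofNat, Real.rpow_ofNat]
  exact (summable_nat_add_iff 1).mpr (SeqSpace.hasSum_sq p).summable

variable [InnerProductSpace ℂ X] [InnerProductSpace ℂ Y]

/-- The block operator with entries `Θ₁₁, Θ₁₂, Θ₂₁, Θ₂₂` is a contraction of `X ⊕ Y`. -/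
def IsBlockContraction (Θ₁₁ : X →L[ℂ] X) (Θ₁₂ : Y →L[ℂ] X) (Θ₂₁ : X →L[ℂ] Y)
    (Θ₂₂ : Y →L[ℂ] Y) : Prop :=
  ∀ a b, ‖Θ₁₁ a + Θ₁₂ b‖ ^ 2 + ‖Θ₂₁ a + Θ₂₂ b‖ ^ 2 ≤ ‖a‖ ^ 2 + ‖b‖ ^ 2

variable {Θ₁₁ : X →L[ℂ] X} {Θ₁₂ : Y →L[ℂ] X} {Θ₂₁ : X →L[ℂ] Y} {Θ₂₂ : Y →L[ℂ] Y}

theorem IsBlockContraction.norm_one_one_le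
    (h : IsBlockContraction Θ₁₁ Θ₁₂ Θ₂₁ Θ₂₂) : ‖Θ₁₁‖ ≤ 1 := by
  refine ContinuousLinearMap.opNorm_le_bound _ zero_le_one fun a => ?_
  have := h a 0
  simp only [map_zero, add_zero, norm_zero] at this
  rw [one_mul]
  exact le_of_sq_le_sq (by nlinarith [sq_nonneg ‖Θ₂₁ a‖]) (norm_nonneg _)

theorem norm_sq_chainOutput_le (h : IsBlockContraction Θ₁₁ Θ₁₂ Θ₂₁ Θ₂₂) (s : X × Y) :
    ‖(WithLp.toLp 2 (Θ₁₁ s.1 + Θ₁₂ s.2, Θ₂₁ s.1 + Θ₂₂ s.2) : WithLp 2 (X × Y))‖ ^ 2 ≤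
      ‖s.1‖ ^ 2 + ‖s.2‖ ^ 2 := by
  rw [WithLp.prod_norm_sq_eq_of_L2]
  exact h s.1 s.2

/-- All cells of the chain work in parallel: `(a, p)` is sent to the sequence of their outputs. -/
noncomputable def chainMap (h : IsBlockContraction Θ₁₁ Θ₁₂ Θ₂₁ Θ₂₂) :
    X × SeqSpace X Y →ₗ[ℂ] SeqSpace X Y where
  toFun q := ⟨fun k => WithLp.toLp 2
      (Θ₁₁ (chainInput q.1 q.2 k).1 + Θ₁₂ (chainInput q.1 q.2 k).2,
        Θ₂₁ (chainInput q.1 q.2 k).1 + Θ₂₂ (chainInput q.1 q.2 k).2), by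
    refine memℓp_gen ?_
    simp only [ENNReal.toReal_ofNat, Real.rpow_ofNat]
    exact Summable.of_nonneg_of_le (fun _ => by positivity)
      (fun _ => norm_sq_chainOutput_le h _) (hasSum_chainInput q.1 q.2).summable⟩
  map_add' q q' := by
    ext k
    rw [lp.coeFn_add, Pi.add_apply]
    apply WithLp.ofLp_injective
    cases k <;> refine Prod.ext ?_ ?_ <;> simp [chainInput] <;> abel
  map_smul' c q := by
    ext k
    rw [RingHom.id_apply, lp.coeFn_smul, Pi.smul_apply]
    apply WithLp.ofLp_injective
    cases k <;> refine Prod.ext ?_ ?_ <;> simp [chainInput]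

theorem norm_sq_chainMap_le (h : IsBlockContraction Θ₁₁ Θ₁₂ Θ₂₁ Θ₂₂) (a : X)
    (p : SeqSpace X Y) :
    ‖chainMap h (a, p)‖ ^ 2 ≤ ‖a‖ ^ 2 + ‖p‖ ^ 2 - ‖(p 0).snd‖ ^ 2 :=
  hasSum_le (fun _ => norm_sq_chainOutput_le h _) (SeqSpace.hasSum_sq (chainMap h (a, p)))
    (hasSum_chainInput a p)

theorem chainMap_shift (h : IsBlockContraction Θ₁₁ Θ₁₂ Θ₂₁ Θ₂₂) (a : X) (p p' : SeqSpace X Y)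
    (hp' : ∀ k, p' k = p (k + 1)) (k : ℕ) :
    chainMap h ((p 0).fst, p') k = chainMap h (a, p) (k + 1) := by
  cases k <;> simp [chainMap, chainInput, hp']

/-- If the powers of `D` are bounded, then `1 - ζ D` is invertible for `|ζ| < 1`. -/
theorem isUnit_one_sub_smul_of_pow_bounded [CompleteSpace X] (D : X →L[ℂ] X) (C : ℝ)
    (hD : ∀ n a, ‖(D ^ n) a‖ ≤ C * ‖a‖) (ζ : ℂ) (hζ : ‖ζ‖ < 1) : IsUnit (1 - ζ • D) := by
  have h0 : Tendsto (fun n : ℕ => ‖ζ‖ ^ n * max C 0) atTop (𝓝 0) := by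
    simpa using (tendsto_pow_atTop_nhds_zero_of_lt_one (norm_nonneg ζ) hζ).mul_const (max C 0)
  obtain ⟨n, hn⟩ := (h0.eventually (gt_mem_nhds one_pos)).exists
  have h1 : ‖(ζ • D) ^ n‖ < 1 := by
    rw [smul_pow, norm_smul, norm_pow]
    refine lt_of_le_of_lt ?_ hn
    gcongr
    exact ContinuousLinearMap.opNorm_le_bound _ (le_max_right _ _) fun a =>
      (hD n a).trans (by gcongr; exact le_max_left _ _)
  have h2 := isUnit_one_sub_of_norm_lt_one h1
  rw [← geom_sum_mul_neg] at h2
  have hc : Commute (∑ i ∈ Finset.range n, (ζ • D) ^ i) (1 - ζ • D) := by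
    unfold Commute SemiconjBy
    rw [geom_sum_mul_neg, mul_neg_geom_sum]
  exact (hc.isUnit_mul_iff.mp h2).2

variable [CompleteSpace X] [CompleteSpace Y]

/-- Consider a semi-infinite chain of cells, each of which applies the strict contraction `rΘ` of
`X ⊕ Y`, receives its `X`-input from the left and its `Y`-input from the right. For every input `a`
of the first cell the chain has a unique square summable state. The operators `K` and `D` read off
the two outputs of the first cell; the chain without its first cell is again such a chain, whence
the equations. -/
theorem exists_riccati_of_strict (h : IsBlockContraction Θ₁₁ Θ₁₂ Θ₂₁ Θ₂₂)
    {r : ℝ} (hr0 : 0 < r) (hr1 : r < 1) :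
    ∃ (K : X →L[ℂ] Y) (D : X →L[ℂ] X), (∀ a, ‖K a‖ ≤ ‖a‖) ∧
      (∀ a, D a = (r : ℂ) • (Θ₁₁ a + Θ₁₂ (K (D a)))) ∧
      (∀ a, K a = (r : ℂ) • (Θ₂₁ a + Θ₂₂ (K (D a)))) ∧
      ∀ ζ : ℂ, ‖ζ‖ < 1 → IsUnit (1 - ζ • D) := by
  have hr : ‖(r : ℂ)‖ = r := by simp [abs_of_pos hr0]
  have hle : ∀ a p, ‖chainMap h (a, p)‖ ^ 2 ≤ ‖a‖ ^ 2 + ‖p‖ ^ 2 := fun a p => by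
    have := norm_sq_chainMap_le h a p
    nlinarith [sq_nonneg ‖(p 0).snd‖]
  let T : SeqSpace X Y →L[ℂ] SeqSpace X Y :=
    LinearMap.mkContinuous ((r : ℂ) • (chainMap h ∘ₗ LinearMap.inr ℂ X (SeqSpace X Y))) r
      fun p => by
        have := hle 0 p
        simp only [LinearMap.smul_apply, LinearMap.comp_apply, LinearMap.inr_apply, norm_smul, hr]
        gcongr
        refine le_of_sq_le_sq ?_ (norm_nonneg _)
        simpa using this
  let B : X →L[ℂ] SeqSpace X Y :=
    LinearMap.mkContinuous ((r : ℂ) • (chainMap h ∘ₗ LinearMap.inl ℂ X (SeqSpace X Y))) r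
      fun a => by
        have := hle a 0
        simp only [LinearMap.smul_apply, LinearMap.comp_apply, LinearMap.inl_apply, norm_smul, hr]
        gcongr
        refine le_of_sq_le_sq ?_ (norm_nonneg _)
        simpa using this
  -- a state `p` with input `a` is a solution of `p = B a + T p`
  have hT : ‖T‖ < 1 := (LinearMap.mkContinuous_norm_le _ hr0.le _).trans_lt hr1
  have hTB : ∀ a p, B a + T p = (r : ℂ) • chainMap h (a, p) := fun a p => by
    change (r : ℂ) • chainMap h (a, 0) + (r : ℂ) • chainMap h (0, p) = _
    rw [← smul_add, ← map_add]
    simp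
  obtain ⟨u, hu⟩ := isUnit_one_sub_of_norm_lt_one hT
  let P : X →L[ℂ] SeqSpace X Y := (↑u⁻¹ : SeqSpace X Y →L[ℂ] SeqSpace X Y) ∘L B
  have hP : ∀ a, P a = (r : ℂ) • chainMap h (a, P a) := fun a => by
    have h1 : (1 - T) (P a) = B a := by
      rw [← hu]
      change ((u : SeqSpace X Y →L[ℂ] SeqSpace X Y) * ↑u⁻¹) (B a) = B a
      simp
    rw [← hTB, ← h1]
    simp
  have huniq : ∀ a p, p = (r : ℂ) • chainMap h (a, p) → p = P a := fun a p hp => by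
    have h1 : (1 - T) p = B a := by
      rw [← hTB] at hp
      change p - T p = B a
      nth_rewrite 1 [hp]
      simp
    change p = (↑u⁻¹ : SeqSpace X Y →L[ℂ] SeqSpace X Y) (B a)
    rw [← h1, ← hu]
    change p = (↑u⁻¹ * (u : SeqSpace X Y →L[ℂ] SeqSpace X Y)) p
    simp
  let ev : SeqSpace X Y →L[ℂ] WithLp 2 (X × Y) := lp.evalCLM ℂ (fun _ => WithLp 2 (X × Y)) 2 0
  let e := (WithLp.prodContinuousLinearEquiv 2 ℂ X Y : WithLp 2 (X × Y) →L[ℂ] X × Y)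
  let K : X →L[ℂ] Y := ContinuousLinearMap.snd ℂ X Y ∘L e ∘L ev ∘L P
  let D : X →L[ℂ] X := ContinuousLinearMap.fst ℂ X Y ∘L e ∘L ev ∘L P
  have hK : ∀ a, K a = (P a 0).snd := fun a => rfl
  have hD : ∀ a, D a = (P a 0).fst := fun a => rfl
  -- removing the first cell leaves the chain with input `D a`
  have hshift : ∀ a k, P (D a) k = P a (k + 1) := fun a k => by
    obtain ⟨p', hp'⟩ := exists_shift (P a)
    have : p' = P (D a) := by
      apply huniq
      ext k
      rw [hD, hp', lp.coeFn_smul, Pi.smul_apply, chainMap_shift h a (P a) p' hp']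
      conv_lhs => rw [hP a]
      rfl
    rw [← this, hp']
  have hcell : ∀ a, P a 0 = (r : ℂ) • WithLp.toLp 2
      (Θ₁₁ a + Θ₁₂ (K (D a)), Θ₂₁ a + Θ₂₂ (K (D a))) := fun a => by
    rw [hK, hshift]
    conv_lhs => rw [hP a]
    rfl
  -- the powers of `D` are read off the cells further along, which bounds them
  have hpow : ∀ n a k, P ((D ^ n) a) k = P a (k + n) := fun n => by
    induction n with
    | zero => intro a k; simp
    | succ n ih =>
      intro a k
      rw [pow_succ, mul_apply_eq_comp, ih, hshift]
      rfl
  refine ⟨K, D, fun a => ?_, fun a => ?_, fun a => ?_, fun ζ hζ => ?_⟩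
  · have h1 := norm_sq_chainMap_le h a (P a)
    have h2 : ‖P a‖ = r * ‖chainMap h (a, P a)‖ := by
      conv_lhs => rw [hP a]
      rw [norm_smul, hr]
    rw [hK]
    refine le_of_sq_le_sq ?_ (norm_nonneg _)
    have h3 : ‖P a‖ ^ 2 ≤ ‖chainMap h (a, P a)‖ ^ 2 := by
      rw [h2, mul_pow]
      have : r ^ 2 ≤ 1 := by nlinarith
      nlinarith [sq_nonneg ‖chainMap h (a, P a)‖]
    linarith
  · exact (hD a).trans (congrArg WithLp.fst (hcell a))
  · exact (hK a).trans (congrArg WithLp.snd (hcell a))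
  · refine isUnit_one_sub_smul_of_pow_bounded D (max ‖P‖ 1) (fun n a => ?_) ζ hζ
    cases n with
    | zero => simpa using le_mul_of_one_le_left (norm_nonneg a) (le_max_right _ _)
    | succ n =>
      have : (D ^ (n + 1)) a = (P a n).fst := by
        rw [pow_succ', mul_apply_eq_comp, hD, hpow, zero_add]
      rw [this]
      calc ‖(P a n).fst‖ ≤ ‖P a n‖ := by
            refine le_of_sq_le_sq ?_ (norm_nonneg _)
            rw [WithLp.prod_norm_sq_eq_of_L2]
            nlinarith [sq_nonneg ‖(P a n).snd‖]
        _ ≤ ‖P a‖ := lp.norm_apply_le_norm (by norm_num) _ _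
        _ ≤ ‖P‖ * ‖a‖ := P.le_opNorm a
        _ ≤ _ := by gcongr; exact le_max_left _ _

end StrictContraction

/-! ### Weak limits and compact operators -/

section WeakLimits

open Filter Topology

variable {ι X Y : Type*}
  [NormedAddCommGroup X] [InnerProductSpace ℂ X]
  [NormedAddCommGroup Y] [InnerProductSpace ℂ Y]

/-- A compact operator is approximated in norm by its compressions to finite dimensional
subspaces. -/
theorem exists_finiteDimensional_norm_sub_le {E : Type*} [NormedAddCommGroup E] [NormedSpace ℂ E]
    {G : E →L[ℂ] X} (hG : IsCompactOperator G) {ε : ℝ} (hε : 0 < ε) :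
    ∃ (V : Submodule ℂ X) (_ : FiniteDimensional ℂ V),
      ‖G - V.starProjection ∘L G‖ ≤ ε := by
  obtain ⟨K, hK, hGK⟩ := hG.image_closedBall_subset_compact (f := (G : E →ₗ[ℂ] X)) 1
  obtain ⟨t, -, htf, ht⟩ := hK.finite_cover_balls hε
  have hfin : FiniteDimensional ℂ (Submodule.span ℂ t) := FiniteDimensional.span_of_finite ℂ htf
  refine ⟨Submodule.span ℂ t, hfin, ?_⟩
  refine ContinuousLinearMap.opNorm_le_of_unit_norm hε.le fun x hx => ?_
  obtain ⟨v, hv, hxv⟩ := Set.mem_iUnion₂.mp (ht (hGK ⟨x, by simp [hx], rfl⟩))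
  have hvs : v ∈ Submodule.span ℂ t := Submodule.subset_span hv
  have h1 : ‖G x - (Submodule.span ℂ t).starProjection (G x)‖ ≤ ‖G x - v‖ := by
    rw [Submodule.starProjection_minimal]
    exact ciInf_le ⟨0, fun _ ⟨_, h⟩ => h ▸ norm_nonneg _⟩ (⟨v, hvs⟩ : Submodule.span ℂ t)
  refine h1.trans ?_
  rw [← dist_eq_norm]
  exact (Metric.mem_ball.mp hxv).le

variable [CompleteSpace X]

/-- Bounded families in a Hilbert space have weak limits along ultrafilters. -/
theorem exists_weak_limit (l : Ultrafilter ι) (x : ι → X) (C : ℝ) (hx : ∀ i, ‖x i‖ ≤ C) :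
    ∃ x₀ : X, ‖x₀‖ ≤ C ∧
      ∀ w, Tendsto (fun i => inner ℂ w (x i)) l (𝓝 (inner ℂ w x₀)) := by
  have hC : 0 ≤ C := by
    obtain ⟨i⟩ := l.neBot.nonempty
    exact (norm_nonneg _).trans (hx i)
  have hlim : ∀ w, ∃ c : ℂ, ‖c‖ ≤ C * ‖w‖ ∧ Tendsto (fun i => inner ℂ (x i) w) l (𝓝 c) := by
    intro w
    have hb : ∀ i, inner ℂ (x i) w ∈ Metric.closedBall (0 : ℂ) (C * ‖w‖) := fun i => by
      rw [mem_closedBall_zero_iff]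
      exact (norm_inner_le_norm _ _).trans (by gcongr; exact hx i)
    obtain ⟨c, hc, hl⟩ := (isCompact_closedBall (0 : ℂ) (C * ‖w‖)).ultrafilter_le_nhds
      (l.map fun i => inner ℂ (x i) w) (by
        rw [Filter.le_principal_iff]
        exact Filter.Eventually.of_forall (f := (l : Filter ι)) hb)
    exact ⟨c, by simpa using hc, hl⟩
  choose φ hφ hφl using hlim
  let f : X →ₗ[ℂ] ℂ :=
    { toFun := φ
      map_add' := fun v w => tendsto_nhds_unique (hφl (v + w)) (by
        simpa only [inner_add_right] using (hφl v).add (hφl w))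
      map_smul' := fun c w => tendsto_nhds_unique (hφl (c • w)) (by
        simpa only [inner_smul_right, RingHom.id_apply, smul_eq_mul] using (hφl w).const_mul c) }
  let F := f.mkContinuous C hφ
  refine ⟨(InnerProductSpace.toDual ℂ X).symm F, ?_, fun w => ?_⟩
  · rw [LinearIsometryEquiv.norm_map]
    exact LinearMap.mkContinuous_norm_le _ hC _
  · have h1 : inner ℂ ((InnerProductSpace.toDual ℂ X).symm F) w = φ w := by
      rw [InnerProductSpace.toDual_symm_apply]; rfl
    have h2 := (Complex.continuous_conj.tendsto _).comp (hφl w)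
    rw [← h1, inner_conj_symm] at h2
    refine h2.congr fun i => ?_
    exact inner_conj_symm _ _

/-- Along an ultrafilter, compact operators turn bounded families into convergent ones. -/
theorem exists_tendsto_of_isCompactOperator {E F : Type*} [NormedAddCommGroup E] [NormedSpace ℂ E]
    [NormedAddCommGroup F] [NormedSpace ℂ F] {G : E →L[ℂ] F}
    (hG : IsCompactOperator G) (l : Ultrafilter ι) (x : ι → E) (C : ℝ) (hx : ∀ i, ‖x i‖ ≤ C) :
    ∃ z, Tendsto (fun i => G (x i)) l (𝓝 z) := by
  obtain ⟨K, hK, hGK⟩ := hG.image_closedBall_subset_compact (f := (G : E →ₗ[ℂ] F)) C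
  obtain ⟨z, -, hz⟩ := hK.ultrafilter_le_nhds (l.map fun i => G (x i)) (by
    rw [Filter.le_principal_iff]
    exact Filter.Eventually.of_forall (f := (l : Filter ι)) fun i =>
      hGK ⟨x i, by simpa using hx i, rfl⟩)
  exact ⟨z, hz⟩

/-- Compact operators turn weak convergence into norm convergence. -/
theorem tendsto_of_isCompactOperator [CompleteSpace Y] {G : X →L[ℂ] Y}
    (hG : IsCompactOperator G) (l : Ultrafilter ι) (x : ι → X) (x₀ : X) (C : ℝ)
    (hx : ∀ i, ‖x i‖ ≤ C)
    (hw : ∀ w, Tendsto (fun i => inner ℂ w (x i)) l (𝓝 (inner ℂ w x₀))) :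
    Tendsto (fun i => G (x i)) l (𝓝 (G x₀)) := by
  obtain ⟨z, hz⟩ := exists_tendsto_of_isCompactOperator hG l x C hx
  have : z = G x₀ := by
    refine ext_inner_left ℂ fun v => ?_
    have h1 : Tendsto (fun i => inner ℂ v (G (x i))) l (𝓝 (inner ℂ v z)) :=
      tendsto_const_nhds.inner hz
    have h2 := hw (ContinuousLinearMap.adjoint G v)
    simp only [ContinuousLinearMap.adjoint_inner_left] at h2
    exact tendsto_nhds_unique h1 h2
  exact this ▸ hz

/-- Families of contractions have contractive limits in the weak operator topology along
ultrafilters. -/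
theorem exists_weak_operator_limit {E : Type*} [NormedAddCommGroup E] [NormedSpace ℂ E]
    (l : Ultrafilter ι) (K : ι → E →L[ℂ] X) (hK : ∀ i a, ‖K i a‖ ≤ ‖a‖) :
    ∃ K₀ : E →L[ℂ] X, (∀ a, ‖K₀ a‖ ≤ ‖a‖) ∧
      ∀ a w, Tendsto (fun i => inner ℂ w (K i a)) l (𝓝 (inner ℂ w (K₀ a))) := by
  choose k hk hkl using fun a => exists_weak_limit l (fun i => K i a) ‖a‖ (fun i => hK i a)
  let f : E →ₗ[ℂ] X :=
    { toFun := k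
      map_add' := fun v w => ext_inner_left ℂ fun u => tendsto_nhds_unique (hkl (v + w) u) (by
        simpa only [inner_add_right, map_add] using (hkl v u).add (hkl w u))
      map_smul' := fun c w => ext_inner_left ℂ fun u => tendsto_nhds_unique (hkl (c • w) u) (by
        simpa only [inner_smul_right, map_smul, RingHom.id_apply] using (hkl w u).const_mul c) }
  exact ⟨f.mkContinuous 1 (fun a => (hk a).trans_eq (one_mul _).symm), hk, hkl⟩

end WeakLimits

/-! ### Compact perturbations of contractions inside the unit disc -/

section Fredholm

open Filter Topology

variable {X : Type*} [NormedAddCommGroup X] [InnerProductSpace ℂ X] [CompleteSpace X]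

theorem isUnit_one_sub_smul {B : X →L[ℂ] X} {ζ : ℂ} (h : ‖ζ‖ * ‖B‖ < 1) :
    IsUnit (1 - ζ • B) :=
  isUnit_one_sub_of_norm_lt_one (by rwa [norm_smul])

theorem differentiableAt_inverse_one_sub_smul {B : X →L[ℂ] X} {ζ : ℂ}
    (h : IsUnit (1 - ζ • B)) :
    DifferentiableAt ℂ (fun z : ℂ => Ring.inverse (1 - z • B)) ζ :=
  DifferentiableAt.comp (g := Ring.inverse) (f := fun z : ℂ => 1 - z • B) ζ
    (differentiableAt_inverse h) (by fun_prop)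

/-- Analytic Fredholm theorem for `1 - ζ (Θ + C)` in the unit disc, `Θ` a contraction and `C`
compact: up to a part of small norm, `C` has finite rank, and non-invertibility becomes the
vanishing of the determinant of a finite matrix, analytic in `ζ` and equal to `1` at `0`. -/
theorem eventually_forall_eq_smul_imp_eq_zero {Θ C : X →L[ℂ] X} (hΘ : ‖Θ‖ ≤ 1)
    (hC : IsCompactOperator C) {ζ₀ : ℂ} (hζ₀ : ‖ζ₀‖ < 1) :
    ∀ᶠ ζ in 𝓝[≠] ζ₀, ∀ x, x = ζ • (Θ x + C x) → x = 0 := by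
  obtain ⟨δ, hδ, hδζ⟩ : ∃ δ : ℝ, 0 < δ ∧ ‖ζ₀‖ * (1 + δ) < 1 := by
    refine ⟨(1 - ‖ζ₀‖) / 2, by linarith, ?_⟩
    nlinarith [norm_nonneg ζ₀]
  obtain ⟨V, hV, hCV⟩ := exists_finiteDimensional_norm_sub_le hC hδ
  set P := V.starProjection
  set B : X →L[ℂ] X := Θ + (C - P ∘L C) with hB
  have hBn : ‖B‖ ≤ 1 + δ := (norm_add_le _ _).trans (add_le_add hΘ hCV)
  let U : Set ℂ := Metric.ball 0 (1 + δ)⁻¹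
  have hUunit : ∀ ζ ∈ U, IsUnit (1 - ζ • B) := fun ζ hζ => by
    apply isUnit_one_sub_smul
    have h1 : ‖ζ‖ < (1 + δ)⁻¹ := by simpa [U] using hζ
    calc ‖ζ‖ * ‖B‖ ≤ ‖ζ‖ * (1 + δ) := by gcongr
      _ < (1 + δ)⁻¹ * (1 + δ) := by gcongr
      _ = 1 := inv_mul_cancel₀ (by positivity)
  let b := stdOrthonormalBasis ℂ V
  -- `1 - ζ (Θ + C)` is singular only if the compression of `1 - ζ C (1 - ζ B)⁻¹` to `V` is
  let N : ℂ → Matrix (Fin (Module.finrank ℂ V)) (Fin (Module.finrank ℂ V)) ℂ := fun ζ =>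
    Matrix.of fun i j => (1 : Matrix _ _ ℂ) i j -
      ζ * inner ℂ (b i : X) (C (Ring.inverse (1 - ζ • B) (b j : X)))
  have hdiff : DifferentiableOn ℂ (fun ζ => (N ζ).det) U := by
    simp only [Matrix.det_apply]
    refine DifferentiableOn.fun_sum fun σ _ => DifferentiableOn.const_smul ?_ _
    refine DifferentiableOn.fun_finsetProd fun i _ => fun ζ hζ => ?_
    refine DifferentiableAt.differentiableWithinAt ?_
    refine (differentiableAt_const _).sub (differentiableAt_id.mul ?_)
    have h1 := differentiableAt_inverse_one_sub_smul (hUunit ζ hζ)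
    have h2 : DifferentiableAt ℂ
        (fun z : ℂ => Ring.inverse (1 - z • B) (b i : X)) ζ :=
      h1.clm_apply (differentiableAt_const _)
    exact ((innerSL ℂ (b (σ i) : X)) ∘L C).differentiableAt.comp ζ h2
  have han : AnalyticOnNhd ℂ (fun ζ => (N ζ).det) U :=
    hdiff.analyticOnNhd Metric.isOpen_ball
  have hpre : IsPreconnected U := (convex_ball _ _).isPreconnected
  have h0U : (0 : ℂ) ∈ U := Metric.mem_ball_self (by positivity)
  have hζU : ζ₀ ∈ U := by
    simp only [U, Metric.mem_ball, dist_zero_right]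
    rw [← one_div, lt_div_iff₀ (by positivity)]
    exact hδζ
  have hN0 : (N 0).det = 1 := by
    have : N 0 = 1 := by
      ext i j
      change (1 : Matrix _ _ ℂ) i j - 0 * _ = _
      rw [zero_mul, sub_zero]
    rw [this, Matrix.det_one]
  have hev : ∀ᶠ ζ in 𝓝[≠] ζ₀, (N ζ).det ≠ 0 := by
    by_contra hcon
    have hfr : ∃ᶠ ζ in 𝓝[≠] ζ₀, (N ζ).det = 0 :=
      (Filter.not_eventually.mp hcon).mono fun _ h => not_not.mp h
    have := han.eqOn_zero_of_preconnected_of_frequently_eq_zero hpre hζU hfr h0U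
    exact one_ne_zero (hN0.symm.trans this)
  have hU' : ∀ᶠ ζ in 𝓝[≠] ζ₀, ζ ∈ U :=
    mem_nhdsWithin_of_mem_nhds (Metric.isOpen_ball.mem_nhds hζU)
  filter_upwards [hev, hU'] with ζ hdet hζ x hx
  by_contra hx0
  refine hdet (Matrix.exists_mulVec_eq_zero_iff.mp ?_)
  set M := Ring.inverse (1 - ζ • B) with hM
  set v : X := P (C x) with hv
  have hvV : v ∈ V := V.starProjection_apply_mem _
  have h1 : (1 - ζ • B) x = ζ • v := by
    have : (1 - ζ • B) x = x - ζ • (Θ x + C x) + ζ • v := by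
      simp only [hB, hv, sub_apply, smul_apply,
        add_apply, ContinuousLinearMap.comp_apply,
        one_apply_eq_self, smul_add, smul_sub]
      abel
    rw [this, ← hx, sub_self, zero_add]
  have h2 : x = ζ • M v := by
    have h3 : M ((1 - ζ • B) x) = x := by
      change (M * (1 - ζ • B)) x = x
      rw [Ring.inverse_mul_cancel _ (hUunit ζ hζ)]; rfl
    rw [h1, map_smul] at h3
    exact h3.symm
  refine ⟨fun j => inner ℂ (b j : X) v, fun hc => hx0 ?_, ?_⟩
  · have hv0 : (⟨v, hvV⟩ : V) = 0 := by
      rw [← b.sum_repr' ⟨v, hvV⟩]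
      refine Finset.sum_eq_zero fun j _ => ?_
      have := congrFun hc j
      simp only [Pi.zero_apply] at this
      rw [Submodule.coe_inner, this, zero_smul]
    have hv0' : v = 0 := congrArg Subtype.val hv0
    rw [h2, hv0', map_zero, smul_zero]
  · have hsum : ∑ j, inner ℂ (b j : X) v • (b j : X) = v := by
      have := congrArg Subtype.val (b.sum_repr' ⟨v, hvV⟩)
      simpa using this
    ext i
    have h4 : ∑ j, inner ℂ (b i : X) (C (M (b j : X))) * inner ℂ (b j : X) v =
        inner ℂ (b i : X) (C (M v)) := by
      conv_rhs => rw [← hsum]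
      simp only [map_sum, map_smul, inner_sum, inner_smul_right, mul_comm]
    have h5 : inner ℂ (b i : X) v = ζ * inner ℂ (b i : X) (C (M v)) := by
      have h6 : inner ℂ (b i : X) v = inner ℂ (b i : X) (C x) := by
        rw [hv, ← Submodule.inner_starProjection_left_eq_right,
          Submodule.starProjection_eq_self_iff.mpr (b i).2]
      rw [h6]
      conv_lhs => rw [h2]
      rw [map_smul, inner_smul_right]
    simp only [Matrix.mulVec, dotProduct, N, Matrix.of_apply, sub_mul, Finset.sum_sub_distrib,
      Pi.zero_apply, mul_assoc, ← Finset.mul_sum, ← hM, h4]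
    simp only [Matrix.one_apply, ite_mul, one_mul, zero_mul, Finset.sum_ite_eq, Finset.mem_univ,
      if_true]
    rw [h5, sub_self]

end Fredholm

/-! ### Passage to the limit in the Riccati equation -/

section RiccatiLimit

open Filter Topology

variable {ι X Y : Type*}
  [NormedAddCommGroup X] [InnerProductSpace ℂ X] [CompleteSpace X]
  [NormedAddCommGroup Y] [InnerProductSpace ℂ Y] [CompleteSpace Y]

/-- Hurwitz type theorem: let `D_i = r_i Θ + C_i` converge strongly to `D = Θ + C`, with `Θ` a
contraction, `C` compact and the `C_i` collectively compact. If no `D_i` has spectrum outside the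
closed unit disc, then neither has `D`. -/
theorem isUnit_one_sub_smul_of_tendsto (l : Ultrafilter ι) {Θ C D : X →L[ℂ] X}
    (hΘ : ‖Θ‖ ≤ 1) (hC : IsCompactOperator C) (hD : D = Θ + C)
    (r : ι → ℂ) (hr : Tendsto r l (𝓝 1)) (C' D' : ι → X →L[ℂ] X)
    (hD' : ∀ i a, D' i a = r i • Θ a + C' i a)
    (hcomp : ∀ y : ι → X, (∀ i, ‖y i‖ ≤ 1) → ∃ z, Tendsto (fun i => C' i (y i)) l (𝓝 z))
    (M : ℝ) (hM : ∀ i a, ‖D' i a‖ ≤ M * ‖a‖)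
    (hlim : ∀ a, Tendsto (fun i => D' i a) l (𝓝 (D a)))
    (hunit : ∀ i, ∀ ζ : ℂ, ‖ζ‖ < 1 → IsUnit (1 - ζ • D' i)) {ζ₀ : ℂ} (hζ₀ : ‖ζ₀‖ < 1) :
    IsUnit (1 - ζ₀ • D) := by
  have hker : ∀ v, v = ζ₀ • D v → v = 0 := by
    intro v hv
    by_contra hv0
    -- a circle around `ζ₀` inside the unit disc on which `1 - ζ D` is injective
    obtain ⟨ρ, hρ, hρ1, hinj⟩ : ∃ ρ : ℝ, 0 < ρ ∧ ‖ζ₀‖ + ρ < 1 ∧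
        ∀ ζ ∈ Metric.sphere ζ₀ ρ, ∀ x, x = ζ • (Θ x + C x) → x = 0 := by
      have h := eventually_forall_eq_smul_imp_eq_zero hΘ hC hζ₀
      rw [eventually_nhdsWithin_iff, Metric.eventually_nhds_iff] at h
      obtain ⟨ε, hε, h⟩ := h
      refine ⟨min (ε / 2) ((1 - ‖ζ₀‖) / 2), lt_min (by linarith) (by linarith), ?_,
        fun ζ hζ => h ?_ ?_⟩
      · linarith [min_le_right (ε / 2) ((1 - ‖ζ₀‖) / 2)]
      · rw [Metric.mem_sphere.mp hζ]
        linarith [min_le_left (ε / 2) ((1 - ‖ζ₀‖) / 2)]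
      · exact Metric.ne_of_mem_sphere hζ (lt_min (by linarith) (by linarith)).ne'
    have hball : ∀ ζ ∈ Metric.closedBall ζ₀ ρ, ‖ζ‖ < 1 := fun ζ hζ => by
      have h1 : ‖ζ - ζ₀‖ ≤ ρ := by rwa [← dist_eq_norm]
      have h2 := norm_le_norm_add_norm_sub' ζ ζ₀
      linarith
    -- the maximum principle moves the singularity at `ζ₀` to the circle
    have hmax : ∀ i, ∃ ζ ∈ Metric.sphere ζ₀ ρ, ∃ y : X,
        y - ζ • D' i y = v - ζ₀ • D' i v ∧ ‖v‖ ≤ ‖y‖ := by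
      intro i
      set w := v - ζ₀ • D' i v with hw
      let f : ℂ → X := fun ζ => Ring.inverse (1 - ζ • D' i) w
      have hf : ∀ ζ, ‖ζ‖ < 1 → f ζ - ζ • D' i (f ζ) = w := fun ζ hζ => by
        change ((1 - ζ • D' i) * Ring.inverse (1 - ζ • D' i)) w = w
        rw [Ring.mul_inverse_cancel _ (hunit i ζ hζ)]; rfl
      have hf0 : f ζ₀ = v := by
        change (Ring.inverse (1 - ζ₀ • D' i)) ((1 - ζ₀ • D' i) v) = v
        change (Ring.inverse (1 - ζ₀ • D' i) * (1 - ζ₀ • D' i)) v = v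
        rw [Ring.inverse_mul_cancel _ (hunit i ζ₀ hζ₀)]; rfl
      have hdiff : DiffContOnCl ℂ f (Metric.ball ζ₀ ρ) := by
        refine DifferentiableOn.diffContOnCl fun ζ hζ => ?_
        rw [closure_ball _ hρ.ne'] at hζ
        exact ((differentiableAt_inverse_one_sub_smul (hunit i ζ (hball ζ hζ))).clm_apply
          (differentiableAt_const _)).differentiableWithinAt
      obtain ⟨ζ, hζ, hmax⟩ := Complex.exists_mem_frontier_isMaxOn_norm Metric.isBounded_ball
        ⟨ζ₀, Metric.mem_ball_self hρ⟩ hdiff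
      rw [frontier_ball _ hρ.ne'] at hζ
      refine ⟨ζ, hζ, f ζ, hf ζ (hball ζ (Metric.sphere_subset_closedBall hζ)), ?_⟩
      have := hmax (subset_closure (Metric.mem_ball_self hρ))
      simpa [hf0] using this
    choose ζ hζ y hy hvy using hmax
    have hvpos : 0 < ‖v‖ := norm_pos_iff.mpr hv0
    have hypos : ∀ i, 0 < ‖y i‖ := fun i => hvpos.trans_le (hvy i)
    -- the normalized solutions
    let u : ι → X := fun i => ((‖y i‖⁻¹ : ℝ) : ℂ) • y i
    have hu : ∀ i, ‖u i‖ = 1 := fun i => by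
      simp only [u, norm_smul, Complex.norm_real, norm_inv, norm_norm]
      exact inv_mul_cancel₀ (hypos i).ne'
    have hres : Tendsto (fun i => u i - ζ i • D' i (u i)) l (𝓝 0) := by
      have h1 : Tendsto (fun i => ‖v‖⁻¹ * ‖v - ζ₀ • D' i v‖) l (𝓝 0) := by
        have := ((tendsto_const_nhds (x := v)).sub ((hlim v).const_smul ζ₀)).norm.const_mul ‖v‖⁻¹
        rwa [← hv, sub_self, norm_zero, mul_zero] at this
      refine squeeze_zero_norm (fun i => ?_) h1
      have h2 : u i - ζ i • D' i (u i) = ((‖y i‖⁻¹ : ℝ) : ℂ) • (v - ζ₀ • D' i v) := by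
        rw [← hy i, smul_sub, smul_comm _ (ζ i)]
        simp only [u, map_smul]
      rw [h2, norm_smul, Complex.norm_real, norm_inv, norm_norm]
      gcongr
      exact hvy i
    obtain ⟨ζ', hζ', hζl⟩ := (isCompact_sphere ζ₀ ρ).ultrafilter_le_nhds (l.map ζ) (by
      rw [Filter.le_principal_iff]
      exact Filter.Eventually.of_forall (f := (l : Filter ι)) hζ)
    replace hζl : Tendsto ζ l (𝓝 ζ') := hζl
    obtain ⟨z, hz⟩ := hcomp u (fun i => (hu i).le)
    have hζ'1 : ‖ζ'‖ < 1 := hball ζ' (Metric.sphere_subset_closedBall hζ')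
    have hN : IsUnit (1 - ζ' • Θ) := isUnit_one_sub_smul (by nlinarith [norm_nonneg ζ'])
    have hNu : Tendsto (fun i => (1 - ζ' • Θ) (u i)) l (𝓝 (ζ' • z)) := by
      have h1 : Tendsto (fun i => (ζ i * r i - ζ') • Θ (u i)) l (𝓝 0) := by
        have h2 : Tendsto (fun i => ‖ζ i * r i - ζ'‖) l (𝓝 0) := by
          have := ((hζl.mul hr).sub_const ζ').norm
          rwa [mul_one, sub_self, norm_zero] at this
        refine squeeze_zero_norm (fun i => ?_) h2
        rw [norm_smul]
        refine mul_le_of_le_one_right (norm_nonneg _) ?_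
        calc ‖Θ (u i)‖ ≤ ‖Θ‖ * ‖u i‖ := Θ.le_opNorm _
          _ ≤ 1 := by rw [hu, mul_one]; exact hΘ
      have h3 := (hres.add h1).add (hζl.smul hz)
      rw [add_zero, zero_add] at h3
      refine h3.congr fun i => ?_
      change _ = u i - ζ' • Θ (u i)
      rw [hD', smul_add, sub_smul, mul_smul]
      abel
    obtain ⟨U, hU⟩ := hN
    have hul : Tendsto u l (𝓝 ((↑U⁻¹ : X →L[ℂ] X) (ζ' • z))) := by
      refine (((↑U⁻¹ : X →L[ℂ] X).continuous.tendsto _).comp hNu).congr fun i => ?_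
      rw [← hU]
      change (↑U⁻¹ * (U : X →L[ℂ] X)) (u i) = u i
      rw [U.inv_mul]; rfl
    set x := (↑U⁻¹ : X →L[ℂ] X) (ζ' • z)
    have hx1 : ‖x‖ = 1 := tendsto_nhds_unique hul.norm (by simp [hu])
    have hDu : Tendsto (fun i => D' i (u i)) l (𝓝 (D x)) := by
      have h1 : Tendsto (fun i => D' i (u i - x)) l (𝓝 0) := by
        have h2 : Tendsto (fun i => M * ‖u i - x‖) l (𝓝 0) := by
          have := (hul.sub_const x).norm.const_mul M
          rwa [sub_self, norm_zero, mul_zero] at this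
        exact squeeze_zero_norm (fun i => hM i _) h2
      have h3 := h1.add (hlim x)
      rw [zero_add] at h3
      refine h3.congr fun i => ?_
      rw [map_sub, sub_add_cancel]
    have hx : x - ζ' • D x = 0 := tendsto_nhds_unique (hul.sub (hζl.smul hDu)) hres
    have hx0 := hinj ζ' hζ' x (by
      rw [sub_eq_zero] at hx
      rw [hD] at hx
      exact hx)
    rw [hx0, norm_zero] at hx1
    exact zero_ne_one hx1
  -- the Fredholm alternative for the compact operator `ζ₀ (1 - ζ₀ Θ)⁻¹ C`
  obtain ⟨U, hU⟩ : IsUnit (1 - ζ₀ • Θ) := isUnit_one_sub_smul (by nlinarith [norm_nonneg ζ₀])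
  let T : X →L[ℂ] X := ζ₀ • ((↑U⁻¹ : X →L[ℂ] X) ∘L C)
  have hT : IsCompactOperator T := (hC.clm_comp (↑U⁻¹ : X →L[ℂ] X)).smul ζ₀
  have hfac : 1 - ζ₀ • D = (U : X →L[ℂ] X) * (1 - T) := by
    have h1 : (U : X →L[ℂ] X) * T = ζ₀ • C := by
      change (U : X →L[ℂ] X) * (ζ₀ • (↑U⁻¹ * C)) = ζ₀ • C
      rw [mul_smul_comm, ← mul_assoc, U.mul_inv, one_mul]
    rw [mul_sub, h1, mul_one, hU, hD, smul_add]
    abel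
  rw [hfac]
  refine U.isUnit.mul ?_
  rcases hT.hasEigenvalue_or_mem_resolventSet one_ne_zero with h | h
  · exfalso
    obtain ⟨v, hv⟩ := h.exists_hasEigenvector
    refine hv.2 (hker v ?_)
    have h1 : T v = v := by simpa using hv.apply_eq_smul
    have h2 : (1 - ζ₀ • D) v = 0 := by
      rw [hfac]
      change (U : X →L[ℂ] X) (v - T v) = 0
      rw [h1, sub_self, map_zero]
    exact sub_eq_zero.mp h2
  · simpa [resolventSet] using h

/-- The Riccati equation `K = Θ₂₁ + Θ₂₂ K D`, `D = Θ₁₁ + Θ₁₂ K D`, of a block contraction with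
compact small `Θ₁₂` and with `Θ₁₁` close to `-1` has a contractive solution `K` for which the
spectral radius of `D` is at most `1`. It is a weak limit of the solutions for `rΘ`, `r → 1`. -/
theorem exists_riccati {Θ₁₁ : X →L[ℂ] X} {Θ₁₂ : Y →L[ℂ] X} {Θ₂₁ : X →L[ℂ] Y} {Θ₂₂ : Y →L[ℂ] Y}
    (h : IsBlockContraction Θ₁₁ Θ₁₂ Θ₂₁ Θ₂₂) (hcpt : IsCompactOperator Θ₁₂)
    (h12 : ‖Θ₁₂‖ ≤ 1 / 4) (h11 : ‖Θ₁₁ + 1‖ ≤ 1 / 4) :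
    ∃ (K : X →L[ℂ] Y) (D : X →L[ℂ] X), (∀ a, ‖K a‖ ≤ ‖a‖) ∧
      (∀ a, D a = Θ₁₁ a + Θ₁₂ (K (D a))) ∧
      (∀ a, K a = Θ₂₁ a + Θ₂₂ (K (D a))) ∧
      IsUnit (1 - D) ∧ ∀ ζ : ℂ, ‖ζ‖ < 1 → IsUnit (1 - ζ • D) := by
  let l : Ultrafilter ℕ := Filter.hyperfilter ℕ
  have hl : (l : Filter ℕ) ≤ atTop := Nat.hyperfilter_le_atTop
  let r : ℕ → ℝ := fun n => 1 - 1 / ((n : ℝ) + 2)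
  have hr0 : ∀ n, 0 < r n := fun n => by
    simp only [r, sub_pos]
    rw [div_lt_one (by positivity)]
    have : (0 : ℝ) ≤ n := n.cast_nonneg
    linarith
  have hr1 : ∀ n, r n < 1 := fun n => by
    have : (0 : ℝ) < 1 / ((n : ℝ) + 2) := by positivity
    simp only [r]; linarith
  have hrl : Tendsto (fun n => (r n : ℂ)) l (𝓝 1) := by
    have h1 : Tendsto r atTop (𝓝 1) := by
      have h2 : Tendsto (fun n : ℕ => 1 / ((n : ℝ) + 2)) atTop (𝓝 0) := by
        simp only [one_div]
        exact tendsto_inv_atTop_zero.comp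
          (tendsto_atTop_add_const_right _ _ tendsto_natCast_atTop_atTop)
      have h3 := h2.const_sub 1
      rwa [sub_zero] at h3
    have := (Complex.continuous_ofReal.tendsto _).comp (h1.mono_left hl)
    rwa [Complex.ofReal_one] at this
  have hrn : ∀ n, ‖(r n : ℂ)‖ ≤ 1 := fun n => by
    rw [Complex.norm_real, Real.norm_of_nonneg (hr0 n).le]; exact (hr1 n).le
  -- the solutions for `r n • Θ`, and a weak limit of the angular operators
  choose K D hKc hDeq hKeq hunit using fun n => exists_riccati_of_strict h (hr0 n) (hr1 n)
  obtain ⟨K₀, hK₀, hKl⟩ := exists_weak_operator_limit l K hKc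
  have h11n : ‖Θ₁₁‖ ≤ 1 := h.norm_one_one_le
  have hΘK : ∀ {K : X →L[ℂ] Y}, (∀ a, ‖K a‖ ≤ ‖a‖) → ∀ a, ‖Θ₁₂ (K a)‖ ≤ 1 / 4 * ‖a‖ :=
    fun hK a => (Θ₁₂.le_opNorm _).trans (by gcongr; exact hK a)
  have hbound : ∀ n a, ‖D n a‖ ≤ 4 / 3 * ‖a‖ := fun n a => by
    have h1 : ‖D n a‖ ≤ ‖a‖ + 1 / 4 * ‖D n a‖ := by
      conv_lhs => rw [hDeq n a]
      rw [norm_smul]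
      refine (mul_le_of_le_one_left (norm_nonneg _) (hrn n)).trans ?_
      refine (norm_add_le _ _).trans (add_le_add ?_ (hΘK (hKc n) _))
      exact (Θ₁₁.le_opNorm a).trans (mul_le_of_le_one_left (norm_nonneg _) h11n)
    linarith
  obtain ⟨U, hU⟩ : IsUnit (1 - Θ₁₂ ∘L K₀) := by
    refine isUnit_one_sub_of_norm_lt_one (lt_of_le_of_lt
      (ContinuousLinearMap.opNorm_le_bound _ (by norm_num) (hΘK hK₀))
      (by norm_num : (1 / 4 : ℝ) < 1))
  -- the limit of the `D n`, determined by the first equation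
  let D₀ : X →L[ℂ] X := (↑U⁻¹ : X →L[ℂ] X) ∘L Θ₁₁
  have hD₀ : ∀ a, D₀ a = Θ₁₁ a + Θ₁₂ (K₀ (D₀ a)) := fun a => by
    have h1 : (1 - Θ₁₂ ∘L K₀) (D₀ a) = Θ₁₁ a := by
      rw [← hU]
      change ((U : X →L[ℂ] X) * ↑U⁻¹) (Θ₁₁ a) = Θ₁₁ a
      rw [U.mul_inv]; rfl
    rw [← h1]
    change D₀ a = D₀ a - Θ₁₂ (K₀ (D₀ a)) + Θ₁₂ (K₀ (D₀ a))
    rw [sub_add_cancel]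
  have hΘKl : ∀ a, Tendsto (fun n => Θ₁₂ (K n a)) l (𝓝 (Θ₁₂ (K₀ a))) := fun a =>
    tendsto_of_isCompactOperator hcpt l (fun n => K n a) (K₀ a) ‖a‖ (fun n => hKc n a) (hKl a)
  have hDl : ∀ a, Tendsto (fun n => D n a) l (𝓝 (D₀ a)) := fun a => by
    have h1 : Tendsto (fun n => 4 / 3 * ‖(r n : ℂ) • (Θ₁₁ a + Θ₁₂ (K n (D₀ a))) - D₀ a‖) l
        (𝓝 0) := by
      have := ((hrl.smul ((tendsto_const_nhds (x := Θ₁₁ a)).add (hΘKl (D₀ a)))).sub_const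
        (D₀ a)).norm.const_mul (4 / 3)
      rwa [← hD₀, one_smul, sub_self, norm_zero, mul_zero] at this
    rw [tendsto_iff_norm_sub_tendsto_zero]
    refine squeeze_zero (fun _ => norm_nonneg _) (fun n => ?_) h1
    have h2 : D n a - D₀ a = ((r n : ℂ) • (Θ₁₁ a + Θ₁₂ (K n (D₀ a))) - D₀ a) +
        (r n : ℂ) • Θ₁₂ (K n (D n a - D₀ a)) := by
      nth_rewrite 1 [hDeq n a]
      simp only [map_sub, smul_add, smul_sub]
      abel
    have h3 : ‖D n a - D₀ a‖ ≤ ‖(r n : ℂ) • (Θ₁₁ a + Θ₁₂ (K n (D₀ a))) - D₀ a‖ +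
        1 / 4 * ‖D n a - D₀ a‖ := by
      conv_lhs => rw [h2]
      refine (norm_add_le _ _).trans (add_le_add le_rfl ?_)
      rw [norm_smul]
      exact (mul_le_of_le_one_left (norm_nonneg _) (hrn n)).trans (hΘK (hKc n) _)
    linarith
  have hKDl : ∀ a w, Tendsto (fun n => inner ℂ w (K n (D n a))) l
      (𝓝 (inner ℂ w (K₀ (D₀ a)))) := fun a w => by
    have h1 : Tendsto (fun n => K n (D n a - D₀ a)) l (𝓝 0) :=
      squeeze_zero_norm (fun n => hKc n _) (tendsto_iff_norm_sub_tendsto_zero.mp (hDl a))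
    have h2 := ((tendsto_const_nhds (x := w)).inner (𝕜 := ℂ) h1).add (hKl (D₀ a) w)
    rw [inner_zero_right, zero_add] at h2
    refine h2.congr fun n => ?_
    rw [map_sub, inner_sub_right, sub_add_cancel]
  refine ⟨K₀, D₀, hK₀, hD₀, fun a => ?_, ?_, fun ζ hζ => ?_⟩
  · refine ext_inner_left ℂ fun w => tendsto_nhds_unique (hKl a w) ?_
    have h1 := hKDl a (ContinuousLinearMap.adjoint Θ₂₂ w)
    simp only [ContinuousLinearMap.adjoint_inner_left] at h1
    have h2 := hrl.mul ((tendsto_const_nhds (x := inner ℂ w (Θ₂₁ a))).add h1)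
    rw [one_mul, ← inner_add_right] at h2
    refine h2.congr fun n => ?_
    rw [← inner_add_right, ← inner_smul_right, ← hKeq n a]
  · have h1 : ‖D₀ + 1‖ ≤ 1 / 4 + 1 / 3 := by
      refine ContinuousLinearMap.opNorm_le_bound _ (by norm_num) fun a => ?_
      have h2 : ‖D₀ a‖ ≤ 4 / 3 * ‖a‖ := le_of_tendsto (hDl a).norm
        (Eventually.of_forall fun n => hbound n a)
      have h3 : (D₀ + 1) a = (Θ₁₁ + 1) a + Θ₁₂ (K₀ (D₀ a)) := by
        change D₀ a + a = Θ₁₁ a + a + _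
        nth_rewrite 1 [hD₀ a]
        abel
      rw [h3]
      have h4 := hΘK hK₀ (D₀ a)
      have h5 : ‖(Θ₁₁ + 1) a‖ ≤ 1 / 4 * ‖a‖ :=
        ((Θ₁₁ + 1).le_opNorm a).trans (by gcongr)
      refine (norm_add_le _ _).trans ?_
      linarith
    have h2 : IsUnit (1 - (2⁻¹ : ℂ) • (D₀ + 1)) := by
      refine isUnit_one_sub_smul ?_
      rw [norm_inv, Complex.norm_ofNat]
      linarith
    have h3 : 1 - D₀ = algebraMap ℂ (X →L[ℂ] X) 2 * (1 - (2⁻¹ : ℂ) • (D₀ + 1)) := by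
      rw [← Algebra.smul_def, smul_sub, smul_smul, mul_inv_cancel₀ two_ne_zero, one_smul, two_smul]
      abel
    rw [h3]
    exact (((isUnit_iff_ne_zero.mpr two_ne_zero).map (algebraMap ℂ (X →L[ℂ] X)))).mul h2
  · refine isUnit_one_sub_smul_of_tendsto l (Θ := Θ₁₁) (C := Θ₁₂ ∘L K₀ ∘L D₀) h11n
      (hcpt.comp_clm (K₀ ∘L D₀)) (by ext a; exact hD₀ a) (fun n => (r n : ℂ)) hrl
      (fun n => (r n : ℂ) • (Θ₁₂ ∘L K n ∘L D n)) D
      (fun n a => (hDeq n a).trans (smul_add _ _ _)) (fun y hy => ?_) (4 / 3) hbound hDl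
      hunit hζ
    obtain ⟨z, hz⟩ := exists_tendsto_of_isCompactOperator hcpt l (fun n => K n (D n (y n))) (4 / 3)
      fun n => (hKc n _).trans ((hbound n _).trans (by
        have := hy n
        linarith))
    exact ⟨(1 : ℂ) • z, hrl.smul hz⟩

end RiccatiLimit

/-! ### Graphs of partially defined operators -/

section Graphs

variable {E F G : Type*}
  [NormedAddCommGroup E] [InnerProductSpace ℂ E]
  [NormedAddCommGroup F] [InnerProductSpace ℂ F]
  [NormedAddCommGroup G] [InnerProductSpace ℂ G]

theorem mk_mem_graph_iff {T : E →ₗ.[ℂ] F} {x : E} {y : F} :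
    (x, y) ∈ T.graph ↔ ∃ h : x ∈ T.domain, T ⟨x, h⟩ = y := by
  rw [LinearPMap.mem_graph_iff]
  constructor
  · rintro ⟨⟨x', h⟩, rfl, hy⟩
    exact ⟨h, hy⟩
  · rintro ⟨h, hy⟩
    exact ⟨⟨x, h⟩, rfl, hy⟩

theorem mem_graph_subScalar {T : E →ₗ.[ℂ] E} {μ : ℂ} {x y : E} :
    (x, y) ∈ (subScalar T μ).graph ↔ (x, y + μ • x) ∈ T.graph := by
  simp only [mk_mem_graph_iff]
  refine exists_congr fun h => ?_
  change -(μ • x) + T ⟨x, h⟩ = y ↔ _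
  rw [neg_add_eq_sub, sub_eq_iff_eq_add]

theorem mem_graph_product {g : F →ₗ.[ℂ] G} {f : E →ₗ.[ℂ] F} {x : E} {z : G} :
    (x, z) ∈ (product g f).graph ↔ ∃ y, (x, y) ∈ f.graph ∧ (y, z) ∈ g.graph := by
  simp only [mk_mem_graph_iff]
  constructor
  · rintro ⟨h, hz⟩
    obtain ⟨⟨⟨x', hx'⟩, hy, rfl⟩, -⟩ := Submodule.mem_inf.mp h
    exact ⟨f ⟨x', hx'⟩, ⟨hx', rfl⟩, hy, hz⟩
  · rintro ⟨y, ⟨hx, rfl⟩, hy, rfl⟩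
    exact ⟨Submodule.mem_inf.mpr ⟨⟨⟨x, hx⟩, hy, rfl⟩, hx⟩, rfl⟩

theorem mem_graph_sub {f g : E →ₗ.[ℂ] F} {x : E} {y : F} :
    (x, y) ∈ (f - g).graph ↔
      ∃ y₁ y₂, (x, y₁) ∈ f.graph ∧ (x, y₂) ∈ g.graph ∧ y = y₁ - y₂ := by
  simp only [mk_mem_graph_iff]
  constructor
  · rintro ⟨h, rfl⟩
    exact ⟨_, _, ⟨h.1, rfl⟩, ⟨h.2, rfl⟩, rfl⟩
  · rintro ⟨_, _, ⟨h₁, rfl⟩, ⟨h₂, rfl⟩, rfl⟩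
    exact ⟨⟨h₁, h₂⟩, rfl⟩

theorem mem_graph_toPMap_top {B : E →L[ℂ] F} {x : E} {y : F} :
    (x, y) ∈ ((B : E →ₗ[ℂ] F).toPMap ⊤).graph ↔ y = B x := by
  rw [mk_mem_graph_iff]
  constructor
  · rintro ⟨-, rfl⟩; rfl
  · rintro rfl; exact ⟨trivial, rfl⟩

theorem mem_graph_compPMap {B : F →ₗ[ℂ] G} {T : E →ₗ.[ℂ] F} {x : E} {z : G} :
    (x, z) ∈ (B.compPMap T).graph ↔ ∃ y, (x, y) ∈ T.graph ∧ z = B y := by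
  simp only [mk_mem_graph_iff]
  constructor
  · rintro ⟨h, rfl⟩
    exact ⟨_, ⟨h, rfl⟩, rfl⟩
  · rintro ⟨_, ⟨h, rfl⟩, rfl⟩
    exact ⟨h, rfl⟩

theorem mem_graph_neg {T : E →ₗ.[ℂ] F} {x : E} {y : F} :
    (x, y) ∈ (-T).graph ↔ (x, -y) ∈ T.graph := by
  simp only [mk_mem_graph_iff]
  refine exists_congr fun h => ?_
  change -T ⟨x, h⟩ = y ↔ _
  rw [neg_eq_iff_eq_neg]

theorem eq_of_mem_graph_iff {f g : E →ₗ.[ℂ] F}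
    (h : ∀ x y, (x, y) ∈ f.graph ↔ (x, y) ∈ g.graph) : f = g :=
  LinearPMap.eq_of_eq_graph (Submodule.ext fun p => h p.1 p.2)

theorem mem_graph_inverse {T : E →ₗ.[ℂ] F} (hT : LinearMap.ker T.toFun = ⊥) {x : E} {y : F} :
    (y, x) ∈ T.inverse.graph ↔ (x, y) ∈ T.graph := by
  rw [LinearPMap.inverse_graph hT]
  constructor
  · rintro ⟨⟨x', y'⟩, h, he⟩
    simp only [LinearEquiv.coe_coe, LinearEquiv.prodComm_apply, Prod.swap_prod_mk,
      Prod.mk.injEq] at he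
    rw [← he.1, ← he.2]
    exact h
  · exact fun h => ⟨(x, y), h, rfl⟩

/-- A densely defined operator with bounded closure is the restriction of an everywhere defined
bounded operator. -/
theorem HasBoundedClosure.exists_extension [CompleteSpace F] {T : E →ₗ.[ℂ] F}
    (h : HasBoundedClosure T) (hT : Dense (T.domain : Set E)) :
    ∃ B : E →L[ℂ] F, ∀ x y, (x, y) ∈ T.graph → y = B x := by
  obtain ⟨-, C, hC⟩ := h
  have hdense : DenseRange T.domain.subtype := by
    rw [DenseRange]
    convert hT
    simp
  have hbound : ∃ C, ∀ x : T.domain, ‖T.toFun x‖ ≤ C * ‖T.domain.subtype x‖ := by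
    refine ⟨C, fun x => ?_⟩
    have h1 := T.le_closure
    have h2 : T x = T.closure ⟨x, h1.1 x.2⟩ := h1.2 rfl
    rw [LinearPMap.toFun_eq_coe, h2]
    exact hC _
  refine ⟨T.toFun.extendOfNorm T.domain.subtype, fun x y hxy => ?_⟩
  obtain ⟨hx, rfl⟩ := mk_mem_graph_iff.mp hxy
  exact (LinearMap.extendOfNorm_eq hdense hbound ⟨x, hx⟩).symm

theorem hasBoundedClosure_of_extension {T : E →ₗ.[ℂ] F} (B : E →L[ℂ] F)
    (hB : ∀ x y, (x, y) ∈ T.graph → y = B x) : HasBoundedClosure T := by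
  have hclosed : IsClosed {p : E × F | p.2 = B p.1} :=
    isClosed_eq continuous_snd (B.continuous.comp continuous_fst)
  have hcl : ∀ p ∈ T.graph.topologicalClosure, p.2 = B p.1 := fun p hp =>
    closure_minimal (fun q hq => hB q.1 q.2 hq) hclosed hp
  have hT : T.IsClosable := by
    refine ⟨T.graph.topologicalClosure.toLinearPMap, ?_⟩
    rw [Submodule.toLinearPMap_graph_eq]
    intro p hp h0
    rw [hcl p hp, h0, map_zero]
  refine ⟨hT, ‖B‖, fun x => ?_⟩
  have h1 := T.closure.mem_graph x
  rw [← hT.graph_closure_eq_closure_graph] at h1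
  have h2 : T.closure x = B x := hcl _ h1
  rw [h2]
  exact B.le_opNorm _

end Graphs

/-! ### Dissipative operators and their resolvents -/

section Dissipative

variable {E : Type*} [NormedAddCommGroup E] [InnerProductSpace ℂ E]

theorem isDissipative_iff {T : E →ₗ.[ℂ] E} :
    IsDissipative T ↔ ∀ x y, (x, y) ∈ T.graph → 0 ≤ (inner ℂ x y).im := by
  constructor
  · intro h x y hxy
    obtain ⟨hx, rfl⟩ := mk_mem_graph_iff.mp hxy
    exact h ⟨x, hx⟩
  · exact fun h x => h _ _ (T.mem_graph x)

/-- Dissipativity passes to the closure of the graph. -/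
theorem im_inner_nonneg_of_mem_closure (J : E →L[ℂ] E) {T : E →ₗ.[ℂ] E}
    (h : ∀ x y, (x, y) ∈ T.graph → 0 ≤ (inner ℂ x (J y)).im) {p : E × E}
    (hp : p ∈ T.graph.topologicalClosure) : 0 ≤ (inner ℂ p.1 (J p.2)).im := by
  have hclosed : IsClosed {p : E × E | 0 ≤ (inner ℂ p.1 (J p.2)).im} :=
    isClosed_le continuous_const (Complex.continuous_im.comp
      (continuous_fst.inner (J.continuous.comp continuous_snd)))
  exact closure_minimal (fun q hq => h q.1 q.2 hq) hclosed hp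

/-- A densely defined operator `T` with `J T` dissipative, `J` injective, is closable. -/
theorem isClosable_of_dissipative (J : E →L[ℂ] E) (hJ : Function.Injective J) {T : E →ₗ.[ℂ] E}
    (h : ∀ x y, (x, y) ∈ T.graph → 0 ≤ (inner ℂ x (J y)).im)
    (hT : Dense (T.domain : Set E)) : T.IsClosable := by
  refine ⟨T.graph.topologicalClosure.toLinearPMap, ?_⟩
  rw [Submodule.toLinearPMap_graph_eq]
  rintro ⟨x, y⟩ hp hx
  change x = 0 at hx
  subst hx
  change y = 0
  have horth : ∀ z ∈ (T.domain : Set E), inner ℂ z (J y) = 0 := by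
    intro z hz
    set α := inner ℂ z (J y) with hα
    set β := (inner ℂ z (J (T ⟨z, hz⟩))).im with hβ
    have key : ∀ t : ℝ, 0 ≤ -t * ‖α‖ ^ 2 + t ^ 2 * ‖α‖ ^ 2 * β := by
      intro t
      -- the choice of scalar makes the term linear in `t` negative
      set c : ℂ := t * (Complex.I * α) with hc
      have h1 : (c • z, y + c • T ⟨z, hz⟩) ∈ T.graph.topologicalClosure := by
        have h2 := T.graph.topologicalClosure.smul_mem c
          (T.graph.le_topologicalClosure (T.mem_graph ⟨z, hz⟩))
        simpa using T.graph.topologicalClosure.add_mem hp h2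
      have h3 := im_inner_nonneg_of_mem_closure J h h1
      simp only [map_add, map_smul, inner_add_right, inner_smul_left, inner_smul_right] at h3
      rw [← hα] at h3
      have h4 : (starRingEnd ℂ) c * α = ((-t * ‖α‖ ^ 2 : ℝ) : ℂ) * Complex.I := by
        rw [hc]
        simp only [map_mul, Complex.conj_ofReal, Complex.conj_I]
        have := Complex.conj_mul' α
        push_cast
        linear_combination (-(t : ℂ) * Complex.I) * this
      have h6 : c * ((starRingEnd ℂ) c * inner ℂ z (J (T ⟨z, hz⟩))) =
          ((t ^ 2 * ‖α‖ ^ 2 : ℝ) : ℂ) * inner ℂ z (J (T ⟨z, hz⟩)) := by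
        have : (starRingEnd ℂ) c * c = ((t ^ 2 * ‖α‖ ^ 2 : ℝ) : ℂ) := by
          rw [Complex.conj_mul', hc, norm_mul, norm_mul, Complex.norm_I, one_mul,
            Complex.norm_real, ← Complex.ofReal_pow, mul_pow, Real.norm_eq_abs, sq_abs]
        rw [← mul_assoc, mul_comm c, this]
      rw [h4] at h3
      simp only [h6, Complex.add_im, Complex.im_ofReal_mul, Complex.I_im, mul_one] at h3
      exact h3
    have h7 := key (1 / (2 * (|β| + 1)))
    have hβ1 : β ≤ |β| := le_abs_self β
    have hβ0 : 0 ≤ |β| := abs_nonneg β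
    set s := 1 / (2 * (|β| + 1)) with hs
    have hs0 : 0 < s := by positivity
    have hs1 : s * (|β| + 1) = 1 / 2 := by rw [hs]; field_simp
    have h8 : s * β ≤ 1 / 2 := by nlinarith
    have h9 : 0 ≤ s * (‖α‖ ^ 2 * (s * β - 1)) := by
      calc 0 ≤ _ := h7
        _ = _ := by ring
    have h10 : ‖α‖ ^ 2 * (s * β - 1) ≥ 0 := nonneg_of_mul_nonneg_right h9 hs0
    have h11 : ‖α‖ ^ 2 ≤ 0 := by nlinarith [sq_nonneg ‖α‖]
    exact norm_eq_zero.mp (pow_eq_zero_iff two_ne_zero |>.mp (le_antisymm h11 (sq_nonneg _)))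
  have h0 : J y = 0 := hT.eq_zero_of_inner_right ℂ (fun v hv => horth v hv)
  exact hJ (h0.trans (map_zero J).symm)

theorem isClosed_graph_of_isMaximalDissipative {T : E →ₗ.[ℂ] E} (h : IsMaximalDissipative T)
    (hT : Dense (T.domain : Set E)) : IsClosed (T.graph : Set (E × E)) := by
  have h1 := isDissipative_iff.mp h.1
  have hcl : T.IsClosable :=
    isClosable_of_dissipative (ContinuousLinearMap.id ℂ E) Function.injective_id h1 hT
  have h2 : T.closure = T := by
    refine h.2 _ T.le_closure (isDissipative_iff.mpr fun x y hxy => ?_)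
    rw [← hcl.graph_closure_eq_closure_graph] at hxy
    exact im_inner_nonneg_of_mem_closure (ContinuousLinearMap.id ℂ E) h1 hxy
  have := hcl.closure_isClosed
  rwa [h2] at this

theorem norm_mul_le_of_dissipative {x y : E} (h : 0 ≤ (inner ℂ x y).im) (ζ : ℂ) :
    -ζ.im * ‖x‖ ≤ ‖y - ζ • x‖ := by
  have h1 : (inner ℂ x (y - ζ • x)).im = (inner ℂ x y).im - ζ.im * ‖x‖ ^ 2 := by
    rw [inner_sub_right, inner_smul_right, inner_self_eq_norm_sq_to_K, Complex.sub_im]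
    congr 1
    have : ((RCLike.ofReal ‖x‖ : ℂ) ^ 2) = ((‖x‖ ^ 2 : ℝ) : ℂ) := by push_cast; rfl
    rw [this, Complex.im_mul_ofReal]
  have h2 : -ζ.im * ‖x‖ ^ 2 ≤ ‖x‖ * ‖y - ζ • x‖ := by
    calc -ζ.im * ‖x‖ ^ 2 ≤ (inner ℂ x (y - ζ • x)).im := by rw [h1]; linarith
      _ ≤ ‖inner ℂ x (y - ζ • x)‖ := (le_abs_self _).trans (Complex.abs_im_le_norm _)
      _ ≤ _ := norm_inner_le_norm _ _
  rcases (norm_nonneg x).eq_or_lt with h0 | h0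
  · rw [← h0, mul_zero]; exact norm_nonneg _
  · refine le_of_mul_le_mul_left ?_ h0
    calc ‖x‖ * (-ζ.im * ‖x‖) = -ζ.im * ‖x‖ ^ 2 := by ring
      _ ≤ _ := h2

/-- `R` is the resolvent `(T - μ)⁻¹`, a bounded operator defined everywhere. -/
structure IsResolvent (T : E →ₗ.[ℂ] E) (μ : ℂ) (R : E →L[ℂ] E) : Prop where
  mem_graph : ∀ y, (R y, y + μ • R y) ∈ T.graph
  left_inv : ∀ x y, (x, y) ∈ T.graph → R (y - μ • x) = x

namespace IsResolvent

variable {T : E →ₗ.[ℂ] E} {μ ν : ℂ} {R Q : E →L[ℂ] E}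

theorem ker_eq_bot (h : IsResolvent T μ R) : LinearMap.ker (subScalar T μ).toFun = ⊥ := by
  rw [LinearMap.ker_eq_bot']
  intro x hx
  have h1 : ((x : E), (0 : E)) ∈ (subScalar T μ).graph :=
    mk_mem_graph_iff.mpr ⟨x.2, hx⟩
  have h2 := h.left_inv _ _ (mem_graph_subScalar.mp h1)
  rw [zero_add, sub_self, map_zero] at h2
  exact Subtype.ext h2.symm

theorem inverse_eq (h : IsResolvent T μ R) :
    (subScalar T μ).inverse = (R : E →ₗ[ℂ] E).toPMap ⊤ := by
  refine eq_of_mem_graph_iff fun y x => ?_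
  rw [mem_graph_inverse h.ker_eq_bot, mem_graph_subScalar, mem_graph_toPMap_top]
  constructor
  · intro hx
    have := h.left_inv _ _ hx
    rw [add_sub_cancel_right] at this
    exact this.symm
  · rintro rfl
    exact h.mem_graph y

theorem isResolventPoint (h : IsResolvent T μ R) : IsResolventPoint T μ :=
  ⟨h.ker_eq_bot, R, h.inverse_eq⟩

/-- The resolvent identity. -/
theorem sub_eq (hR : IsResolvent T μ R) (hQ : IsResolvent T ν Q) (y : E) :
    R y = Q y + (μ - ν) • R (Q y) := by
  have h1 := hR.left_inv _ _ (hQ.mem_graph y)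
  rw [add_sub_assoc, ← sub_smul, map_add, map_smul] at h1
  rw [← neg_sub ν μ, neg_smul, ← sub_eq_add_neg, eq_sub_iff_add_eq]
  exact h1

theorem injective (h : IsResolvent T μ R) : Function.Injective R := by
  rw [injective_iff_map_eq_zero]
  intro y hy
  have h1 := h.mem_graph y
  rw [hy, smul_zero, add_zero] at h1
  exact T.graph_fst_eq_zero_snd h1 rfl

end IsResolvent

variable [CompleteSpace E]

/-- The open lower half-plane consists of regular points of a densely defined maximal dissipative
operator `T`: a vector orthogonal to the range of `T - ζ` would be an eigenvector of a proper
dissipative extension, with eigenvalue `conj ζ`. -/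
theorem exists_mem_graph_sub_smul_eq {T : E →ₗ.[ℂ] E} (h : IsMaximalDissipative T)
    (hT : Dense (T.domain : Set E)) {ζ : ℂ} (hζ : ζ.im < 0) (w : E) :
    ∃ x y, (x, y) ∈ T.graph ∧ y - ζ • x = w := by
  have hgr := isClosed_graph_of_isMaximalDissipative h hT
  have hdis := isDissipative_iff.mp h.1
  have : CompleteSpace T.graph := hgr.completeSpace_coe
  let S : E × E →L[ℂ] E := ContinuousLinearMap.snd ℂ E E - ζ • ContinuousLinearMap.fst ℂ E E
  let S' : T.graph →L[ℂ] E := S ∘L T.graph.subtypeL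
  have hS' : ∀ p : T.graph, S' p = p.1.2 - ζ • p.1.1 := fun p => rfl
  have hanti : ∃ C, AntilipschitzWith C S' := by
    refine ⟨⟨(1 + ‖ζ‖) / (-ζ.im) + 1, by have : 0 < -ζ.im := by linarith
                                         positivity⟩, ?_⟩
    refine ContinuousLinearMap.antilipschitz_of_bound _ fun p => ?_
    have hpos : 0 < -ζ.im := by linarith
    have h1 : ‖p.1.1‖ ≤ ‖S' p‖ / (-ζ.im) := by
      rw [le_div_iff₀ hpos, mul_comm, hS']
      exact norm_mul_le_of_dissipative (hdis _ _ p.2) ζ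
    have h2 : ‖p.1.2‖ ≤ ‖S' p‖ + ‖ζ‖ * ‖p.1.1‖ := by
      have : p.1.2 = S' p + ζ • p.1.1 := by rw [hS', sub_add_cancel]
      calc ‖p.1.2‖ = ‖S' p + ζ • p.1.1‖ := by rw [← this]
        _ ≤ _ := (norm_add_le _ _).trans_eq (by rw [norm_smul])
    have h3 : ‖ζ‖ * ‖p.1.1‖ ≤ ‖ζ‖ * (‖S' p‖ / (-ζ.im)) := by gcongr
    have h4 : ‖p‖ ≤ ‖p.1.1‖ + ‖p.1.2‖ := max_le (le_add_of_nonneg_right (norm_nonneg _))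
      (le_add_of_nonneg_left (norm_nonneg _))
    change ‖p‖ ≤ ((1 + ‖ζ‖) / (-ζ.im) + 1) * ‖S' p‖
    calc ‖p‖ ≤ ‖S' p‖ / (-ζ.im) + (‖S' p‖ + ‖ζ‖ * (‖S' p‖ / (-ζ.im))) := by linarith
      _ = _ := by ring
  obtain ⟨C, hC⟩ := hanti
  have hclosed : IsClosed (S'.range : Set E) := by
    rw [LinearMap.coe_range]
    exact hC.isClosed_range S'.uniformContinuous
  have htop : S'.range = ⊤ := by
    rw [← hclosed.submodule_topologicalClosure_eq, Submodule.topologicalClosure_eq_top_iff,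
      Submodule.eq_bot_iff]
    intro v hv
    by_contra hv0
    have hvS : ∀ x y, (x, y) ∈ T.graph → inner ℂ v y = ζ * inner ℂ v x := by
      intro x y hxy
      have h1 := (Submodule.mem_orthogonal' _ _).mp hv (S' ⟨(x, y), hxy⟩) ⟨_, rfl⟩
      rw [hS', inner_sub_right, inner_smul_right] at h1
      exact sub_eq_zero.mp h1
    have hvv : inner ℂ v v = ((‖v‖ ^ 2 : ℝ) : ℂ) := by
      rw [inner_self_eq_norm_sq_to_K]; push_cast; rfl
    have hvpos : 0 < ‖v‖ ^ 2 := by have := norm_pos_iff.mpr hv0; positivity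
    have hvd : v ∉ T.domain := by
      intro hvd
      have h1 := hvS v _ (T.mem_graph ⟨v, hvd⟩)
      have h2 := hdis v _ (T.mem_graph ⟨v, hvd⟩)
      rw [h1, hvv, Complex.im_mul_ofReal] at h2
      nlinarith
    have hle : T ≤ T.supSpanSingleton v ((starRingEnd ℂ) ζ • v) hvd :=
      LinearPMap.left_le_sup _ _ _
    have hext := h.2 _ hle (by
      rintro ⟨u, hu⟩
      obtain ⟨x, hx, _, hs, rfl⟩ := Submodule.mem_sup.mp hu
      obtain ⟨c, rfl⟩ := Submodule.mem_span_singleton.mp hs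
      rw [LinearPMap.supSpanSingleton_apply_mk _ _ _ _ _ hx]
      have h1 := hdis x _ (T.mem_graph ⟨x, hx⟩)
      have h2 := hvS x _ (T.mem_graph ⟨x, hx⟩)
      simp only [RingHom.id_apply, inner_add_left, inner_add_right, inner_smul_left,
        inner_smul_right, h2, hvv]
      set a := inner ℂ v x with ha
      have h3 : inner ℂ x v = (starRingEnd ℂ) a := (inner_conj_symm x v).symm
      rw [h3]
      have h5 : c * ((starRingEnd ℂ) ζ * (starRingEnd ℂ) a) =
          (starRingEnd ℂ) ((starRingEnd ℂ) c * (ζ * a)) := by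
        simp
      have h6 : c * ((starRingEnd ℂ) ζ * ((starRingEnd ℂ) c * ((‖v‖ ^ 2 : ℝ) : ℂ))) =
          ((‖c‖ ^ 2 * ‖v‖ ^ 2 : ℝ) : ℂ) * (starRingEnd ℂ) ζ := by
        have := Complex.conj_mul' c
        push_cast
        linear_combination ((starRingEnd ℂ) ζ * (‖v‖ : ℂ) ^ 2) * this
      simp only [mul_add, h5, h6, Complex.add_im, Complex.conj_im, Complex.im_ofReal_mul]
      have h7 : 0 ≤ ‖c‖ ^ 2 * ‖v‖ ^ 2 * -ζ.im := by
        have : 0 ≤ -ζ.im := by linarith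
        positivity
      linarith)
    refine hvd ?_
    rw [← hext]
    exact Submodule.mem_sup_right (Submodule.mem_span_singleton_self v)
  obtain ⟨⟨⟨x, y⟩, hxy⟩, hp⟩ := (Submodule.eq_top_iff'.mp htop) w
  exact ⟨x, y, hxy, hp⟩

/-- If `-T` is maximal dissipative and densely defined, the open upper half-plane lies in the
resolvent set of `T`. -/
theorem exists_isResolvent {T : E →ₗ.[ℂ] E} (h : IsMaximalDissipative (-T))
    (hT : Dense (T.domain : Set E)) {μ : ℂ} (hμ : 0 < μ.im) :
    ∃ R : E →L[ℂ] E, IsResolvent T μ R ∧ ‖R‖ ≤ 1 / μ.im := by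
  have hμ' : (-μ).im < 0 := by simpa using hμ
  have hdis := isDissipative_iff.mp h.1
  have hex : ∀ w, ∃ x, (x, w + μ • x) ∈ T.graph := fun w => by
    obtain ⟨x, y, hxy, hw⟩ := exists_mem_graph_sub_smul_eq h hT hμ' (-w)
    refine ⟨x, ?_⟩
    have h1 : w + μ • x = -y := by
      rw [neg_smul, sub_neg_eq_add] at hw
      rw [eq_neg_iff_add_eq_zero, add_assoc, add_comm _ y, hw, add_neg_cancel]
    rw [h1]
    exact mem_graph_neg.mp hxy
  have hbd : ∀ x y, (x, y) ∈ T.graph → μ.im * ‖x‖ ≤ ‖y - μ • x‖ := fun x y hxy => by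
    have h1 : (x, -y) ∈ (-T).graph := mem_graph_neg.mpr (by rwa [neg_neg])
    have h2 := norm_mul_le_of_dissipative (hdis _ _ h1) (-μ)
    rw [Complex.neg_im, neg_neg, neg_smul, sub_neg_eq_add, neg_add_eq_sub, norm_sub_rev] at h2
    exact h2
  have huniq : ∀ x y x' y', (x, y) ∈ T.graph → (x', y') ∈ T.graph →
      y - μ • x = y' - μ • x' → x = x' := fun x y x' y' hx hx' he => by
    have h1 := hbd _ _ (T.graph.sub_mem hx hx')
    have h2 : y - y' - μ • (x - x') = 0 := by
      rw [smul_sub, sub_sub_sub_comm, he, sub_self]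
    simp only [] at h1
    rw [h2, norm_zero] at h1
    have h3 : ‖x - x'‖ ≤ 0 := by
      by_contra hcon
      push Not at hcon
      nlinarith
    exact sub_eq_zero.mp (norm_le_zero_iff.mp h3)
  choose φ hφ using hex
  let R₀ : E →ₗ[ℂ] E :=
    { toFun := φ
      map_add' := fun v w => huniq _ _ _ _ (hφ _) (T.graph.add_mem (hφ v) (hφ w)) (by
        simp only [smul_add]; abel)
      map_smul' := fun c w => huniq _ _ _ _ (hφ _) (T.graph.smul_mem c (hφ w)) (by
        simp only [RingHom.id_apply, smul_add, smul_comm c μ]; abel) }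
  have hbound : ∀ w, ‖R₀ w‖ ≤ 1 / μ.im * ‖w‖ := fun w => by
    have h1 := hbd _ _ (hφ w)
    rw [add_sub_cancel_right] at h1
    rw [one_div, inv_mul_eq_div, le_div_iff₀ hμ, mul_comm]
    exact h1
  refine ⟨R₀.mkContinuous _ hbound, ⟨hφ, fun x y hxy => ?_⟩,
    LinearMap.mkContinuous_norm_le _ (by positivity) _⟩
  exact huniq _ _ _ _ (hφ _) hxy (add_sub_cancel_right _ _)

end Dissipative

/-! ### The fundamental decomposition -/

section Decomposition

variable {H : Type*} [NormedAddCommGroup H] [InnerProductSpace ℂ H]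

theorem coe_toPlus (J : H →L[ℂ] H) (w : H) : (toPlus J w : H) = (2⁻¹ : ℂ) • (w + J w) := rfl

theorem coe_toMinus (J : H →L[ℂ] H) (w : H) : (toMinus J w : H) = (2⁻¹ : ℂ) • (w - J w) := rfl

theorem toPlus_add_toMinus (J : H →L[ℂ] H) (w : H) :
    (toPlus J w : H) + (toMinus J w : H) = w := by
  rw [coe_toPlus, coe_toMinus, ← smul_add, add_add_sub_cancel, ← two_smul ℂ w, smul_smul,
    inv_mul_cancel₀ two_ne_zero, one_smul]

/-- `P₊` as a bounded operator onto `H⁺`. -/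
noncomputable def toPlusL (J : H →L[ℂ] H) : H →L[ℂ] plusSpace J :=
  ⟨toPlus J, (projPlus J).continuous.subtype_mk _⟩

/-- `P₋` as a bounded operator onto `H⁻`. -/
noncomputable def toMinusL (J : H →L[ℂ] H) : H →L[ℂ] minusSpace J :=
  ⟨toMinus J, (projMinus J).continuous.subtype_mk _⟩

theorem mem_graph_block {V : Type*} [AddCommGroup V] [Module ℂ V] {A : H →ₗ.[ℂ] H}
    {U : Submodule ℂ H} {p : H →ₗ[ℂ] V} {u : U} {v : V} :
    (u, v) ∈ (block A U p).graph ↔ ∃ w, ((u : H), w) ∈ A.graph ∧ v = p w := by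
  rw [LinearPMap.mem_graph_iff]
  constructor
  · rintro ⟨y, rfl, rfl⟩
    exact ⟨_, A.mem_graph ⟨((y : U) : H), y.2⟩, rfl⟩
  · rintro ⟨w, h, rfl⟩
    obtain ⟨hu, rfl⟩ := mk_mem_graph_iff.mp h
    exact ⟨⟨u, hu⟩, rfl, rfl⟩

variable [CompleteSpace H] {J : H →L[ℂ] H}

namespace IsFundamentalSymmetry

theorem apply_apply (hJ : IsFundamentalSymmetry J) (x : H) : J (J x) = x :=
  congrArg (fun B : H →L[ℂ] H => B x) hJ.mul_self

theorem injective (hJ : IsFundamentalSymmetry J) : Function.Injective J :=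
  Function.LeftInverse.injective hJ.apply_apply

theorem inner_apply_left (hJ : IsFundamentalSymmetry J) (x y : H) :
    inner ℂ (J x) y = inner ℂ x (J y) := by
  conv_rhs => rw [← hJ.isSelfAdjoint.adjoint_eq]
  rw [ContinuousLinearMap.adjoint_inner_right]

theorem apply_plus (hJ : IsFundamentalSymmetry J) (a : plusSpace J) : J a = a := by
  obtain ⟨_, w, rfl⟩ := a
  change J ((2⁻¹ : ℂ) • (w + J w)) = (2⁻¹ : ℂ) • (w + J w)
  rw [map_smul, map_add, hJ.apply_apply, add_comm]

theorem apply_minus (hJ : IsFundamentalSymmetry J) (b : minusSpace J) : J b = -(b : H) := by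
  obtain ⟨_, w, rfl⟩ := b
  change J ((2⁻¹ : ℂ) • (w - J w)) = -((2⁻¹ : ℂ) • (w - J w))
  rw [map_smul, map_sub, hJ.apply_apply, ← smul_neg, neg_sub]

variable (hJ : IsFundamentalSymmetry J)
include hJ

theorem toPlus_plus (a : plusSpace J) : toPlus J (a : H) = a := by
  ext
  rw [coe_toPlus, hJ.apply_plus, ← two_smul ℂ (a : H), smul_smul, inv_mul_cancel₀ two_ne_zero,
    one_smul]

theorem toMinus_plus (a : plusSpace J) : toMinus J (a : H) = 0 := by
  ext
  rw [coe_toMinus, hJ.apply_plus, sub_self, smul_zero]; rfl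

theorem toPlus_minus (b : minusSpace J) : toPlus J (b : H) = 0 := by
  ext
  rw [coe_toPlus, hJ.apply_minus, add_neg_cancel, smul_zero]; rfl

theorem toMinus_minus (b : minusSpace J) : toMinus J (b : H) = b := by
  ext
  rw [coe_toMinus, hJ.apply_minus, sub_neg_eq_add, ← two_smul ℂ (b : H), smul_smul,
    inv_mul_cancel₀ two_ne_zero, one_smul]

theorem toPlus_add (a : plusSpace J) (b : minusSpace J) : toPlus J ((a : H) + b) = a := by
  rw [map_add, hJ.toPlus_plus, hJ.toPlus_minus, add_zero]

theorem toMinus_add (a : plusSpace J) (b : minusSpace J) : toMinus J ((a : H) + b) = b := by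
  rw [map_add, hJ.toMinus_plus, hJ.toMinus_minus, zero_add]

theorem inner_plus_minus (a : plusSpace J) (b : minusSpace J) : inner ℂ (a : H) (b : H) = 0 := by
  have h := hJ.inner_apply_left (a : H) (b : H)
  rw [hJ.apply_plus, hJ.apply_minus, inner_neg_right] at h
  exact self_eq_neg.mp h

theorem inner_minus_plus (a : plusSpace J) (b : minusSpace J) : inner ℂ (b : H) (a : H) = 0 := by
  rw [← inner_conj_symm, hJ.inner_plus_minus, map_zero]

/-- The indefinite form in terms of the components. -/
theorem inner_apply_add (a a' : plusSpace J) (b b' : minusSpace J) :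
    inner ℂ ((a : H) + b) (J ((a' : H) + b')) = inner ℂ a a' - inner ℂ b b' := by
  rw [map_add, hJ.apply_plus, hJ.apply_minus, inner_add_left, inner_add_right, inner_add_right,
    inner_neg_right, inner_neg_right, hJ.inner_plus_minus, hJ.inner_minus_plus,
    Submodule.coe_inner, Submodule.coe_inner]
  ring

theorem completeSpace_plusSpace : CompleteSpace (plusSpace J) := by
  have h : (plusSpace J : Set H) = {x | J x = x} := by
    ext x
    constructor
    · exact fun hx => hJ.apply_plus ⟨x, hx⟩
    · intro hx
      have h1 : (toPlus J x : H) = x := by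
        rw [coe_toPlus, show J x = x from hx, ← two_smul ℂ x, smul_smul,
          inv_mul_cancel₀ two_ne_zero, one_smul]
      rw [← h1]
      exact (toPlus J x).2
  have h2 : IsClosed (plusSpace J : Set H) := by
    rw [h]
    exact isClosed_eq J.continuous continuous_id
  exact h2.completeSpace_coe

theorem completeSpace_minusSpace : CompleteSpace (minusSpace J) := by
  have h : (minusSpace J : Set H) = {x | J x = -x} := by
    ext x
    constructor
    · exact fun hx => hJ.apply_minus ⟨x, hx⟩
    · intro hx
      have h1 : (toMinus J x : H) = x := by
        rw [coe_toMinus, show J x = -x from hx, sub_neg_eq_add, ← two_smul ℂ x, smul_smul,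
          inv_mul_cancel₀ two_ne_zero, one_smul]
      rw [← h1]
      exact (toMinus J x).2
  have h2 : IsClosed (minusSpace J : Set H) := by
    rw [h]
    exact isClosed_eq J.continuous continuous_id.neg
  exact h2.completeSpace_coe

end IsFundamentalSymmetry

theorem dense_comap_plusSpace (hJ : IsFundamentalSymmetry J) {D : Submodule ℂ H}
    (hdom : D = (D ⊓ plusSpace J) ⊔ (D ⊓ minusSpace J)) (hdense : Dense (D : Set H)) :
    Dense (D.comap (plusSpace J).subtype : Set (plusSpace J)) := by
  have hsurj : Function.Surjective (toPlusL J) := fun a => ⟨a, hJ.toPlus_plus a⟩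
  refine (hsurj.denseRange.dense_image (toPlusL J).continuous hdense).mono ?_
  rintro _ ⟨x, hx, rfl⟩
  have hx' : x ∈ (D ⊓ plusSpace J) ⊔ (D ⊓ minusSpace J) := hdom ▸ hx
  obtain ⟨p, hp, q, hq, rfl⟩ := Submodule.mem_sup.mp hx'
  have h1 : toPlusL J (p + q) = ⟨p, hp.2⟩ := hJ.toPlus_add ⟨p, hp.2⟩ ⟨q, hq.2⟩
  rw [h1]
  exact hp.1

theorem dense_comap_minusSpace (hJ : IsFundamentalSymmetry J) {D : Submodule ℂ H}
    (hdom : D = (D ⊓ plusSpace J) ⊔ (D ⊓ minusSpace J)) (hdense : Dense (D : Set H)) :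
    Dense (D.comap (minusSpace J).subtype : Set (minusSpace J)) := by
  have hsurj : Function.Surjective (toMinusL J) := fun a => ⟨a, hJ.toMinus_minus a⟩
  refine (hsurj.denseRange.dense_image (toMinusL J).continuous hdense).mono ?_
  rintro _ ⟨x, hx, rfl⟩
  have hx' : x ∈ (D ⊓ plusSpace J) ⊔ (D ⊓ minusSpace J) := hdom ▸ hx
  obtain ⟨p, hp, q, hq, rfl⟩ := Submodule.mem_sup.mp hx'
  have h1 : toMinusL J (p + q) = ⟨q, hq.2⟩ := hJ.toMinus_add ⟨p, hp.2⟩ ⟨q, hq.2⟩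
  rw [h1]
  exact hq.1

end Decomposition

/-! ### The Frobenius–Schur data of the block operator -/

section Schur

open Filter Topology

variable {H : Type*} [NormedAddCommGroup H] [InnerProductSpace ℂ H]

/-- `R = (A₂₂ - μ)⁻¹`, the operators `F` and `S` are bounded extensions of `F(μ)` and `S(μ)`, and
`G = A₁₂ R`. -/
structure IsSchurData (J : H →L[ℂ] H) (A : H →ₗ.[ℂ] H) (μ : ℂ)
    (R : minusSpace J →L[ℂ] minusSpace J) (F : plusSpace J →L[ℂ] minusSpace J)
    (G : minusSpace J →L[ℂ] plusSpace J) (S : plusSpace J →L[ℂ] plusSpace J) : Prop where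
  resolvent : IsResolvent (block22 J A) μ R
  eq_F : ∀ a f, (a, f) ∈ (opF J A μ).graph → f = F a
  mem_G : ∀ y, (R y, G y) ∈ (block12 J A).graph
  compact : IsCompactOperator G
  eq_S : ∀ a s, (a, s) ∈ (opS J A μ).graph → s = S a

variable {J : H →L[ℂ] H} {A : H →ₗ.[ℂ] H} {μ ν : ℂ}
  {R Q : minusSpace J →L[ℂ] minusSpace J}

theorem mem_graph_opF (hR : IsResolvent (block22 J A) μ R) {a : plusSpace J} {f : minusSpace J} :
    (a, f) ∈ (opF J A μ).graph ↔ ∃ w, (a, w) ∈ (block21 J A).graph ∧ f = R w := by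
  rw [opF, mem_graph_product]
  refine exists_congr fun w => and_congr_right fun _ => ?_
  rw [resolvent22, hR.inverse_eq, mem_graph_toPMap_top]

theorem mem_graph_opG (hR : IsResolvent (block22 J A) μ R) {y : minusSpace J} {g : plusSpace J} :
    (y, g) ∈ (opG J A μ).graph ↔ (R y, g) ∈ (block12 J A).graph := by
  rw [opG, mem_graph_product, resolvent22, hR.inverse_eq]
  simp only [mem_graph_toPMap_top, exists_eq_left]

/-- The domains of the terms of `S(μ)` impose nothing beyond `a ∈ D⁺`. -/
theorem mem_graph_opS (hR : IsResolvent (block22 J A) μ R) {a s : plusSpace J} :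
    (a, s) ∈ (opS J A μ).graph ↔ ∃ w₁ w g, (a, w₁) ∈ (block11 J A).graph ∧
      (a, w) ∈ (block21 J A).graph ∧ (R w, g) ∈ (block12 J A).graph ∧ s = w₁ - g := by
  rw [opS, mem_graph_sub]
  simp only [mem_graph_product, mem_graph_opF hR]
  constructor
  · rintro ⟨w₁, g, h₁, ⟨_, ⟨w, hw, rfl⟩, hg⟩, rfl⟩
    exact ⟨w₁, w, g, h₁, hw, hg, rfl⟩
  · rintro ⟨w₁, w, g, h₁, hw, hg, rfl⟩
    exact ⟨w₁, g, h₁, ⟨_, ⟨w, hw, rfl⟩, hg⟩, rfl⟩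

theorem IsResolvent.mem_domain_block12 (hR : IsResolvent (block22 J A) μ R) (y : minusSpace J) :
    ∃ g, (R y, g) ∈ (block12 J A).graph := by
  obtain ⟨w, hw, -⟩ := mem_graph_block.mp (hR.mem_graph y)
  exact ⟨_, mem_graph_block.mpr ⟨w, hw, rfl⟩⟩

theorem IsResolvent.eq_apply_add (hR : IsResolvent (block22 J A) μ R)
    (hQ : IsResolvent (block22 J A) ν Q) (y : minusSpace J) :
    R y = Q (y + (μ - ν) • R y) := by
  have h := hQ.sub_eq hR y
  rw [map_add, map_smul, h, add_assoc, ← add_smul]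
  simp

/-- Operators `W_n` with `Q W_n → 0` in norm, `Q` injective, converge weakly to `0`; hence
`G W_n → 0` in norm for compact `G`. -/
theorem tendsto_norm_comp_of_isCompactOperator {X Y : Type*}
    [NormedAddCommGroup X] [InnerProductSpace ℂ X] [CompleteSpace X]
    [NormedAddCommGroup Y] [InnerProductSpace ℂ Y] [CompleteSpace Y]
    {G : Y →L[ℂ] X} (hG : IsCompactOperator G) {Q : Y →L[ℂ] Y} (hQ : Function.Injective Q)
    (W : ℕ → Y →L[ℂ] Y) (M : ℝ) (hM : ∀ n, ‖W n‖ ≤ M)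
    (hW : Tendsto (fun n => ‖Q ∘L W n‖) atTop (𝓝 0)) :
    Tendsto (fun n => ‖G ∘L W n‖) atTop (𝓝 0) := by
  have hex : ∀ n, ∃ y : Y, ‖y‖ ≤ 1 ∧ ‖G ∘L W n‖ ≤ 2 * ‖G (W n y)‖ := fun n => by
    rcases (norm_nonneg (G ∘L W n)).eq_or_lt with h0 | h0
    · exact ⟨0, by simp, by rw [← h0]; positivity⟩
    · obtain ⟨y, hy, hlt⟩ := (G ∘L W n).exists_lt_apply_of_lt_opNorm (half_lt_self h0)
      refine ⟨y, hy.le, ?_⟩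
      have : ‖G ∘L W n‖ / 2 < ‖G (W n y)‖ := hlt
      linarith
  choose y hy hGy using hex
  have hWy : ∀ n, ‖W n (y n)‖ ≤ M := fun n =>
    ((W n).le_opNorm _).trans ((mul_le_of_le_one_right (norm_nonneg _) (hy n)).trans (hM n))
  have hlim : Tendsto (fun n => G (W n (y n))) atTop (𝓝 0) := by
    rw [tendsto_iff_ultrafilter]
    intro l hl
    obtain ⟨x, -, hx⟩ := exists_weak_limit l (fun n => W n (y n)) M hWy
    have hQx : Q x = 0 := by
      refine ext_inner_left ℂ fun w => ?_
      have h1 : Tendsto (fun n => Q (W n (y n))) l (𝓝 0) := by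
        refine squeeze_zero_norm (fun n => ?_) (hW.mono_left hl)
        exact ((Q ∘L W n).le_opNorm _).trans (mul_le_of_le_one_right (norm_nonneg _) (hy n))
      have h2 := hx (ContinuousLinearMap.adjoint Q w)
      simp only [ContinuousLinearMap.adjoint_inner_left] at h2
      exact tendsto_nhds_unique h2 (tendsto_const_nhds.inner h1)
    have hx0 : x = 0 := hQ (hQx.trans (map_zero Q).symm)
    have := tendsto_of_isCompactOperator hG l (fun n => W n (y n)) x M hWy hx
    rwa [hx0, map_zero] at this
  have h3 := hlim.norm.const_mul 2
  rw [norm_zero, mul_zero] at h3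
  exact squeeze_zero (fun _ => norm_nonneg _) hGy h3

variable [CompleteSpace H]

/-- The resolvent identity carries the properties of `F(μ)`, `G(μ)`, `S(μ)` from one point of the
open upper half-plane to all others. On the imaginary axis `G(iη) → 0`, by compactness, and
therefore `S(iη) = o(η)`. -/
theorem exists_isSchurData (hJ : IsFundamentalSymmetry J)
    (hdom : A.domain = (A.domain ⊓ plusSpace J) ⊔ (A.domain ⊓ minusSpace J))
    (hdense : Dense (A.domain : Set H))
    (h_i : IsMaximalDissipative (-block22 J A))
    (h_ii : ∃ μ : ℂ, 0 < μ.im ∧ HasBoundedClosure (opF J A μ))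
    (h_iii : ∃ μ : ℂ, 0 < μ.im ∧ IsCompactPMap (opG J A μ))
    (h_iv : ∃ μ : ℂ, 0 < μ.im ∧ HasBoundedClosure (opS J A μ)) :
    (∀ μ : ℂ, 0 < μ.im → ∃ R F G S, IsSchurData J A μ R F G S) ∧
      ∃ (η : ℝ) (R : _) (F : _) (G : _) (S : _), 0 < η ∧
        IsSchurData J A (η * Complex.I) R F G S ∧ ‖G‖ ≤ 1 / 8 ∧ ‖S‖ ≤ η / 8 := by
  have := hJ.completeSpace_plusSpace
  have := hJ.completeSpace_minusSpace
  have hDp := dense_comap_plusSpace hJ hdom hdense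
  have hDm := dense_comap_minusSpace hJ hdom hdense
  choose! R hR hRn using fun (μ : ℂ) (hμ : 0 < μ.im) => exists_isResolvent h_i hDm hμ
  have h21 : ∀ a : plusSpace J, (a : H) ∈ A.domain → ∃ w, (a, w) ∈ (block21 J A).graph :=
    fun a ha => ⟨_, mem_graph_block.mpr ⟨_, A.mem_graph ⟨a, ha⟩, rfl⟩⟩
  have h11 : ∀ a : plusSpace J, (a : H) ∈ A.domain → ∃ w, (a, w) ∈ (block11 J A).graph :=
    fun a ha => ⟨_, mem_graph_block.mpr ⟨_, A.mem_graph ⟨a, ha⟩, rfl⟩⟩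
  obtain ⟨μ₂, hμ₂, hF⟩ := h_ii
  obtain ⟨μ₃, hμ₃, G₀, hG₀, hG₀c⟩ := h_iii
  obtain ⟨μ₄, hμ₄, hS⟩ := h_iv
  obtain ⟨F₀, hF₀⟩ := hF.exists_extension (hDp.mono fun a ha => by
    obtain ⟨w, hw⟩ := h21 a ha
    exact LinearPMap.mem_domain_of_mem_graph ((mem_graph_opF (hR μ₂ hμ₂)).mpr ⟨w, hw, rfl⟩))
  obtain ⟨S₀, hS₀⟩ := hS.exists_extension (hDp.mono fun a ha => by
    obtain ⟨w, hw⟩ := h21 a ha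
    obtain ⟨w₁, hw₁⟩ := h11 a ha
    obtain ⟨g, hg⟩ := (hR μ₄ hμ₄).mem_domain_block12 w
    exact LinearPMap.mem_domain_of_mem_graph
      ((mem_graph_opS (hR μ₄ hμ₄)).mpr ⟨w₁, w, g, hw₁, hw, hg, rfl⟩))
  have hG₀' : ∀ y, (R μ₃ y, G₀ y) ∈ (block12 J A).graph := fun y => by
    rw [← mem_graph_opG (hR μ₃ hμ₃), hG₀, mem_graph_toPMap_top]
  let F : ℂ → plusSpace J →L[ℂ] minusSpace J := fun μ => F₀ + (μ - μ₂) • (R μ ∘L F₀)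
  let W : ℂ → minusSpace J →L[ℂ] minusSpace J := fun μ => 1 + (μ - μ₃) • R μ
  let G : ℂ → minusSpace J →L[ℂ] plusSpace J := fun μ => G₀ ∘L W μ
  let S : ℂ → plusSpace J →L[ℂ] plusSpace J := fun μ => S₀ - (μ - μ₄) • (G μ ∘L F μ₄)
  -- the resolvent identity, `R(μ₃) W(μ) = R(μ)`
  have hRW : ∀ μ, 0 < μ.im → ∀ y, R μ₃ (W μ y) = R μ y := fun μ hμ y =>
    ((hR μ hμ).eq_apply_add (hR μ₃ hμ₃) y).symm
  have hFμ : ∀ μ, 0 < μ.im → ∀ a w, (a, w) ∈ (block21 J A).graph → R μ w = F μ a := by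
    intro μ hμ a w hw
    have h1 : R μ₂ w = F₀ a := hF₀ _ _ ((mem_graph_opF (hR μ₂ hμ₂)).mpr ⟨w, hw, rfl⟩)
    rw [(hR μ hμ).sub_eq (hR μ₂ hμ₂), h1]
    rfl
  have hGμ : ∀ μ, 0 < μ.im → ∀ y, (R μ y, G μ y) ∈ (block12 J A).graph := by
    intro μ hμ y
    rw [← hRW μ hμ]
    exact hG₀' _
  have hdata : ∀ μ, 0 < μ.im → IsSchurData J A μ (R μ) (F μ) (G μ) (S μ) := by
    intro μ hμ
    refine ⟨hR μ hμ, fun a f haf => ?_, hGμ μ hμ, hG₀c.comp_clm (W μ), fun a s has => ?_⟩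
    · obtain ⟨w, hw, rfl⟩ := (mem_graph_opF (hR μ hμ)).mp haf
      exact hFμ μ hμ a w hw
    · obtain ⟨w₁, w, g, hw₁, hw, hg, rfl⟩ := (mem_graph_opS (hR μ hμ)).mp has
      have h1 := hS₀ _ _ ((mem_graph_opS (hR μ₄ hμ₄)).mpr
        ⟨w₁, w, G μ₄ w, hw₁, hw, hGμ μ₄ hμ₄ w, rfl⟩)
      have h2 : (R μ w, G μ₄ w + (μ - μ₄) • G μ (F μ₄ a)) ∈ (block12 J A).graph := by
        rw [(hR μ hμ).sub_eq (hR μ₄ hμ₄), hFμ μ₄ hμ₄ a w hw]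
        have h3 := hGμ μ₄ hμ₄ w
        rw [hFμ μ₄ hμ₄ a w hw] at h3
        exact (block12 J A).graph.add_mem h3
          ((block12 J A).graph.smul_mem (μ - μ₄) (hGμ μ hμ (F μ₄ a)))
      rw [LinearPMap.mem_graph_snd_inj _ hg h2 rfl]
      change _ = S₀ a - (μ - μ₄) • G μ (F μ₄ a)
      rw [← h1]
      abel
  refine ⟨fun μ hμ => ⟨_, _, _, _, hdata μ hμ⟩, ?_⟩
  let η : ℕ → ℝ := fun n => n + 1
  have hη : ∀ n, 1 ≤ η n := fun n => by simp [η]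
  have hη0 : ∀ n, 0 < η n := fun n => by have := hη n; linarith
  have hηinv : Tendsto (fun n => 1 / η n) atTop (𝓝 0) := tendsto_one_div_add_atTop_nhds_zero_nat
  let z : ℕ → ℂ := fun n => η n * Complex.I
  have hzim : ∀ n, (z n).im = η n := fun n => by simp [z]
  have hzn : ∀ n, ‖z n‖ = η n := fun n => by simp [z, abs_of_pos (hη0 n)]
  have hz : ∀ n, 0 < (z n).im := fun n => by rw [hzim]; exact hη0 n
  have hRz : ∀ n, ‖R (z n)‖ ≤ 1 / η n := fun n => by
    have := hRn (z n) (hz n)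
    rwa [hzim] at this
  -- `R(μ₃) W(z n) = R(z n) → 0`, so compactness of `G₀` gives `G(z n) = G₀ W(z n) → 0`
  have hGz : Tendsto (fun n => ‖G (z n)‖) atTop (𝓝 0) := by
    refine tendsto_norm_comp_of_isCompactOperator hG₀c (hR μ₃ hμ₃).injective (fun n => W (z n))
      (2 + ‖μ₃‖) (fun n => ?_) ?_
    · have h1 : ‖(z n - μ₃) • R (z n)‖ ≤ (η n + ‖μ₃‖) * (1 / η n) := by
        rw [norm_smul]
        refine mul_le_mul ((norm_sub_le _ _).trans_eq (by rw [hzn])) (hRz n) (norm_nonneg _) ?_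
        have := hη0 n
        positivity
      have h2 : (η n + ‖μ₃‖) * (1 / η n) ≤ 1 + ‖μ₃‖ := by
        rw [mul_one_div, div_le_iff₀ (hη0 n)]
        nlinarith [norm_nonneg μ₃, hη n]
      have h3 : ‖(1 : minusSpace J →L[ℂ] minusSpace J)‖ ≤ 1 := ContinuousLinearMap.norm_id_le
      have h4 : ‖W (z n)‖ ≤ ‖(1 : minusSpace J →L[ℂ] minusSpace J)‖ + ‖(z n - μ₃) • R (z n)‖ :=
        norm_add_le (1 : minusSpace J →L[ℂ] minusSpace J) ((z n - μ₃) • R (z n))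
      change ‖W (z n)‖ ≤ 2 + ‖μ₃‖
      linarith
    · refine squeeze_zero (fun _ => norm_nonneg _) (fun n => ?_) hηinv
      have h1 : R μ₃ ∘L W (z n) = R (z n) := by
        ext1 y
        exact hRW (z n) (hz n) y
      rw [h1]
      exact hRz n
  have hSz : Tendsto (fun n => ‖S (z n)‖ * (1 / η n)) atTop (𝓝 0) := by
    have h1 : Tendsto (fun n => ‖S₀‖ * (1 / η n) + (1 + ‖μ₄‖) * (‖G (z n)‖ * ‖F μ₄‖)) atTop
        (𝓝 0) := by
      simpa using (hηinv.const_mul ‖S₀‖).add ((hGz.mul_const ‖F μ₄‖).const_mul (1 + ‖μ₄‖))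
    refine squeeze_zero (fun n => ?_) (fun n => ?_) h1
    · have := hη0 n; positivity
    have h2 : ‖S (z n)‖ ≤ ‖S₀‖ + (η n + ‖μ₄‖) * (‖G (z n)‖ * ‖F μ₄‖) := by
      have h3 : ‖S (z n)‖ ≤ ‖S₀‖ + ‖(z n - μ₄) • (G (z n) ∘L F μ₄)‖ :=
        norm_sub_le S₀ ((z n - μ₄) • (G (z n) ∘L F μ₄))
      refine h3.trans (add_le_add le_rfl ?_)
      calc ‖(z n - μ₄) • (G (z n) ∘L F μ₄)‖
          ≤ ‖z n - μ₄‖ * ‖G (z n) ∘L F μ₄‖ := ContinuousLinearMap.opNorm_smul_le _ _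
        _ ≤ (η n + ‖μ₄‖) * (‖G (z n)‖ * ‖F μ₄‖) := by
          gcongr
          · exact (norm_sub_le _ _).trans_eq (by rw [hzn])
          · exact ContinuousLinearMap.opNorm_comp_le _ _
    have h3 : (η n + ‖μ₄‖) * (1 / η n) ≤ 1 + ‖μ₄‖ := by
      rw [mul_one_div, div_le_iff₀ (hη0 n)]
      nlinarith [norm_nonneg μ₄, hη n]
    have h4 : 0 ≤ 1 / η n := by have := hη0 n; positivity
    have h5 : 0 ≤ ‖G (z n)‖ * ‖F μ₄‖ := by positivity
    calc ‖S (z n)‖ * (1 / η n)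
        ≤ (‖S₀‖ + (η n + ‖μ₄‖) * (‖G (z n)‖ * ‖F μ₄‖)) * (1 / η n) := by gcongr
      _ = ‖S₀‖ * (1 / η n) + ((η n + ‖μ₄‖) * (1 / η n)) * (‖G (z n)‖ * ‖F μ₄‖) := by ring
      _ ≤ _ := by gcongr
  obtain ⟨n, hn1, hn2⟩ := ((hGz.eventually (ge_mem_nhds (by norm_num : (0 : ℝ) < 1 / 8))).and
    (hSz.eventually (ge_mem_nhds (by norm_num : (0 : ℝ) < 1 / 8)))).exists
  refine ⟨η n, _, _, _, _, hη0 n, hdata (z n) (hz n), hn1, ?_⟩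
  rw [mul_one_div, div_le_iff₀ (hη0 n)] at hn2
  linarith

end Schur

/-! ### The invariant graph in terms of the Frobenius–Schur data -/

section Angular

open Complex

variable {X Y : Type*}
  [NormedAddCommGroup X] [InnerProductSpace ℂ X]
  [NormedAddCommGroup Y] [InnerProductSpace ℂ Y]

/-- With `u = (a, R z - F a)` and `A u = (S a + G z, z + iη (R z - F a))`, the inequality
`Im [A u, u] ≥ 0`. -/
def IsDissipativeData (η : ℝ) (R : Y →L[ℂ] Y) (F : X →L[ℂ] Y) (G : Y →L[ℂ] X) (S : X →L[ℂ] X) :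
    Prop :=
  ∀ a z, 0 ≤ (inner ℂ a (S a + G z) -
    inner ℂ (R z - F a) (z + (η * I : ℂ) • (R z - F a))).im

variable {η : ℝ} {R : Y →L[ℂ] Y} {F : X →L[ℂ] Y} {G : Y →L[ℂ] X} {S : X →L[ℂ] X}

/-- The operator `S` is dissipative. -/
theorem IsDissipativeData.im_inner_nonneg (h : IsDissipativeData η R F G S) (hη : 0 < η) (a : X) :
    0 ≤ (inner ℂ a (S a)).im := by
  have h1 := h a 0
  have h2 : (inner ℂ (-F a) (-F a) : ℂ) = ((‖F a‖ ^ 2 : ℝ) : ℂ) := by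
    rw [inner_neg_neg, inner_self_eq_norm_sq_to_K]; push_cast; rfl
  simp only [map_zero, add_zero, zero_sub, zero_add] at h1
  rw [inner_smul_right, h2, sub_im, im_mul_ofReal, im_ofReal_mul, I_im, mul_one] at h1
  have : 0 ≤ η * ‖F a‖ ^ 2 := by positivity
  linarith

/-- The polarization behind the Cayley transform. -/
theorem norm_sub_smul_I_sq {E : Type*} [NormedAddCommGroup E] [InnerProductSpace ℂ E] (η : ℝ)
    (p a : E) :
    ‖p + (η * I : ℂ) • a‖ ^ 2 - ‖p - (η * I : ℂ) • a‖ ^ 2 = 4 * η * (inner ℂ a p).im := by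
  have h1 : RCLike.re (inner ℂ p ((η * I : ℂ) • a)) = η * (inner ℂ a p).im := by
    have h2 : (inner ℂ p a : ℂ).im = -(inner ℂ a p : ℂ).im := by
      rw [← inner_conj_symm p a, conj_im]
    rw [inner_smul_right]
    simp [h2]
  rw [norm_add_sq (𝕜 := ℂ), norm_sub_sq (𝕜 := ℂ), h1]
  ring

variable [CompleteSpace X]

/-- Dissipativity makes `S + iη` invertible. -/
theorem IsDissipativeData.exists_unit (h : IsDissipativeData η R F G S) (hη : 0 < η) :
    ∃ U : (X →L[ℂ] X)ˣ, (∀ a, (U : X →L[ℂ] X) a = S a + (η * I : ℂ) • a) ∧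
      ‖(↑U⁻¹ : X →L[ℂ] X)‖ ≤ 1 / η := by
  have him : ∀ a, η * ‖a‖ ^ 2 ≤ (inner ℂ a (S a + (η * I : ℂ) • a)).im := fun a => by
    have h2 : (inner ℂ a a : ℂ) = ((‖a‖ ^ 2 : ℝ) : ℂ) := by
      rw [inner_self_eq_norm_sq_to_K]; push_cast; rfl
    rw [inner_add_right, inner_smul_right, h2, add_im, im_mul_ofReal, im_ofReal_mul, I_im, mul_one]
    linarith [h.im_inner_nonneg hη a]
  have hbd : ∀ a, η * ‖a‖ ^ 2 ≤ ‖inner ℂ a (S a + (η * I : ℂ) • a)‖ := fun a =>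
    (him a).trans ((le_abs_self _).trans (abs_im_le_norm _))
  obtain ⟨U, hU⟩ : IsUnit (S + (η * I : ℂ) • (1 : X →L[ℂ] X)) := by
    refine ContinuousLinearMap.isUnit_of_forall_le_norm_inner_map _ (c := ⟨η, hη.le⟩) hη fun a => ?_
    rw [norm_inner_symm, mul_comm]
    exact hbd a
  have hUa : ∀ a, (U : X →L[ℂ] X) a = S a + (η * I : ℂ) • a := fun a => by rw [hU]; rfl
  refine ⟨U, hUa, ContinuousLinearMap.opNorm_le_bound _ (by positivity) fun b => ?_⟩
  set a := (↑U⁻¹ : X →L[ℂ] X) b with ha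
  have hb : b = S a + (η * I : ℂ) • a := by
    rw [← hUa, ha]
    change b = (U * ↑U⁻¹ : X →L[ℂ] X) b
    rw [U.mul_inv]; rfl
  have h1 : η * ‖a‖ ^ 2 ≤ ‖a‖ * ‖b‖ := by
    have := hbd a
    rw [← hb] at this
    exact this.trans (norm_inner_le_norm _ _)
  rw [one_div, inv_mul_eq_div, le_div_iff₀ hη]
  rcases (norm_nonneg a).eq_or_lt with h0 | h0
  · rw [← h0, zero_mul]; exact norm_nonneg _
  · refine le_of_mul_le_mul_left ?_ h0
    calc ‖a‖ * (‖a‖ * η) = η * ‖a‖ ^ 2 := by ring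
      _ ≤ _ := h1

variable [CompleteSpace Y]

/-- Existence of the angular operator `K` of an invariant graph subspace, `B` being the restriction
of `A` to the graph in the coordinate `a ↦ (a, K a)`. The map `(A + iηJ) u ↦ (A - iηJ) u` is a
contraction; its block equation for `K` is the Riccati equation, with `B` the Cayley transform
`iη (1 + D) (1 - D)⁻¹` of `D`. -/
theorem IsDissipativeData.exists_angular (h : IsDissipativeData η R F G S) (hη : 0 < η)
    (hG : IsCompactOperator G) (hGn : ‖G‖ ≤ 1 / 8) (hSn : ‖S‖ ≤ η / 8) :
    ∃ (K : X →L[ℂ] Y) (B : X →L[ℂ] X), (∀ a, ‖K a‖ ≤ ‖a‖) ∧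
      (∀ a, ∃ z, K a = R z - F a ∧ B a = S a + G z ∧ K (B a) = z + (η * I : ℂ) • K a) ∧
      ∀ ζ : ℂ, ζ.im < 0 → IsUnit (algebraMap ℂ (X →L[ℂ] X) ζ - B) := by
  obtain ⟨U, hU, hUn⟩ := h.exists_unit hη
  set V : X →L[ℂ] X := (↑U⁻¹ : X →L[ℂ] X) with hV
  have hUV : ∀ b, S (V b) + (η * I : ℂ) • V b = b := fun b => by
    rw [← hU]
    change (U * ↑U⁻¹ : X →L[ℂ] X) b = b
    rw [U.mul_inv]; rfl
  set κ : ℂ := 2 * (η * I) with hκ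
  have hκ0 : κ ≠ 0 := by simp [hκ, hη.ne']
  have hκn : ‖κ‖ = 2 * η := by simp [hκ, abs_of_pos hη]
  let Θ₁₁ : X →L[ℂ] X := 1 - κ • V
  let Θ₁₂ : Y →L[ℂ] X := κ • (V ∘L G)
  let Θ₂₁ : X →L[ℂ] Y := -(κ • (F ∘L V))
  let Θ₂₂ : Y →L[ℂ] Y := 1 + κ • R + κ • (F ∘L V ∘L G)
  have e1 : ∀ b z, Θ₁₁ b + Θ₁₂ z = b - κ • V (b - G z) := fun b z => by
    change b - κ • V b + κ • V (G z) = _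
    rw [map_sub, smul_sub]; abel
  have e2 : ∀ b z, Θ₂₁ b + Θ₂₂ z = z + κ • (R z - F (V (b - G z))) := fun b z => by
    change -(κ • F (V b)) + (z + κ • R z + κ • F (V (G z))) = _
    rw [map_sub, map_sub, smul_sub, smul_sub]; abel
  -- at `b = (S + iη) a + G z` the block operator maps `(A + iηJ) u` to `(A - iηJ) u`
  have hΘ : IsBlockContraction Θ₁₁ Θ₁₂ Θ₂₁ Θ₂₂ := by
    intro b z
    rw [e1, e2]
    set a := V (b - G z) with ha
    have hb : b = (S a + G z) + (η * I : ℂ) • a := by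
      have := hUV (b - G z)
      rw [← ha] at this
      rw [add_right_comm, this, sub_add_cancel]
    set u := R z - F a with hu
    have h1 : b - κ • a = (S a + G z) - (η * I : ℂ) • a := by
      rw [hκ, mul_smul, two_smul, ← sub_sub]
      nth_rewrite 1 [hb]
      rw [add_sub_cancel_right]
    have h2 : z + κ • u = (z + (η * I : ℂ) • u) + (η * I : ℂ) • u := by
      rw [hκ, mul_smul, two_smul, add_assoc]
    have h3 := norm_sub_smul_I_sq η (S a + G z) a
    have h4 := norm_sub_smul_I_sq η (z + (η * I : ℂ) • u) u
    have h5 := h a z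
    rw [← hu, sub_im] at h5
    rw [← hb, ← h1] at h3
    rw [← h2, add_sub_cancel_right] at h4
    have h6 : 0 ≤ 4 * η * ((inner ℂ a (S a + G z)).im -
        (inner ℂ u (z + (η * I : ℂ) • u)).im) := by positivity
    linarith
  have hVc : ‖κ‖ * ‖V‖ ≤ 2 := by
    rw [hκn]
    calc 2 * η * ‖V‖ ≤ 2 * η * (1 / η) := by gcongr
      _ = 2 := by field_simp
  have h12 : ‖Θ₁₂‖ ≤ 1 / 4 := by
    calc ‖Θ₁₂‖ = ‖κ‖ * ‖V ∘L G‖ := norm_smul _ _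
      _ ≤ ‖κ‖ * (‖V‖ * ‖G‖) := by gcongr; exact ContinuousLinearMap.opNorm_comp_le _ _
      _ = (‖κ‖ * ‖V‖) * ‖G‖ := by ring
      _ ≤ 2 * (1 / 8) := by gcongr
      _ = 1 / 4 := by norm_num
  have h11 : ‖Θ₁₁ + 1‖ ≤ 1 / 4 := by
    have h1 : Θ₁₁ + 1 = (2 : ℂ) • (S ∘L V) := by
      ext b
      change b - κ • V b + b = (2 : ℂ) • S (V b)
      nth_rewrite 1 3 [← hUV b]
      rw [hκ]
      module
    rw [h1, norm_smul, Complex.norm_ofNat]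
    calc 2 * ‖S ∘L V‖ ≤ 2 * (‖S‖ * ‖V‖) := by gcongr; exact ContinuousLinearMap.opNorm_comp_le _ _
      _ ≤ 2 * (η / 8 * (1 / η)) := by gcongr
      _ = 1 / 4 := by field_simp; norm_num
  have hcpt : IsCompactOperator Θ₁₂ := (hG.clm_comp V).smul κ
  obtain ⟨K, D, hK, hD, hKD, ⟨N, hN⟩, hspec⟩ := exists_riccati hΘ hcpt h12 h11
  let P : X →L[ℂ] X := ↑N⁻¹
  let B : X →L[ℂ] X := κ • P - (η * I : ℂ) • 1
  have hNP : ∀ a, P a - D (P a) = a := fun a => by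
    change (1 - D) (P a) = a
    rw [← hN]
    change (N * ↑N⁻¹ : X →L[ℂ] X) a = a
    rw [N.mul_inv]; rfl
  refine ⟨K, B, hK, fun a => ?_, fun ζ hζ => ?_⟩
  · set b := κ • P a with hb
    have hba : b - D b = κ • a := by
      rw [hb, map_smul, ← smul_sub, hNP]
    set z := K (D b) with hz
    have hD' := hD b
    have hK' := hKD b
    rw [← hz, e1] at hD'
    rw [← hz, e2] at hK'
    have hVa : V (b - G z) = a := by
      have h1 : κ • V (b - G z) = κ • a := by
        calc κ • V (b - G z) = b - (b - κ • V (b - G z)) := (sub_sub_cancel _ _).symm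
          _ = b - D b := by rw [← hD']
          _ = κ • a := hba
      exact smul_right_injective X hκ0 h1
    rw [hVa] at hK'
    have hKa : K a = R z - F a := by
      have h1 : κ • K a = κ • (R z - F a) := by
        rw [← map_smul, ← hba, map_sub, ← hz, hK', add_sub_cancel_left]
      exact smul_right_injective Y hκ0 h1
    have hBa : B a = b - (η * I : ℂ) • a := rfl
    refine ⟨z, hKa, ?_, ?_⟩
    · have h1 := hUV (b - G z)
      rw [hVa] at h1
      rw [hBa, sub_eq_iff_eq_add, add_right_comm, h1, sub_add_cancel]
    · rw [hBa, map_sub, hK', map_smul, ← hKa, hκ, mul_smul, two_smul]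
      abel
  · have hne : ζ - η * I ≠ 0 := by
      intro h0
      have := congrArg Complex.im h0
      simp only [sub_im, im_ofReal_mul, I_im, mul_one, zero_im] at this
      linarith
    set ω := (ζ + η * I) / (ζ - η * I) with hω
    have hω1 : ‖ω‖ < 1 := by
      rw [hω, norm_div, div_lt_one (norm_pos_iff.mpr hne)]
      refine lt_of_pow_lt_pow_left₀ 2 (norm_nonneg _) ?_
      rw [Complex.sq_norm, Complex.sq_norm, Complex.normSq_apply, Complex.normSq_apply]
      simp only [add_re, add_im, sub_re, sub_im, im_ofReal_mul, re_ofReal_mul, I_re, I_im, mul_zero,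
        mul_one, add_zero, sub_zero]
      nlinarith [mul_pos hη (neg_pos.mpr hζ)]
    -- the Cayley transform takes the lower half-plane to the outside of the unit disc
    have hfac : algebraMap ℂ (X →L[ℂ] X) ζ - B =
        algebraMap ℂ (X →L[ℂ] X) (ζ - η * I) * (1 - ω • D) * P := by
      ext a
      have h1 : (ζ - η * I) * ω = ζ + η * I := by rw [hω, mul_div_cancel₀ _ hne]
      change ζ • a - (κ • P a - (η * I : ℂ) • a) = (ζ - η * I) • (P a - ω • D (P a))
      rw [smul_sub, smul_smul, h1]
      have h2 : D (P a) = P a - a := by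
        nth_rewrite 3 [← hNP a]
        abel
      rw [h2, hκ]
      module
    rw [hfac]
    exact (((isUnit_iff_ne_zero.mpr hne).map _).mul (hspec ω hω1)).mul N⁻¹.isUnit

end Angular

/-! ### The closure of the block operator -/

section Closure

variable {H : Type*} [NormedAddCommGroup H] [InnerProductSpace ℂ H] {J : H →L[ℂ] H}
  {A : H →ₗ.[ℂ] H}

theorem isDissipativeIn_iff :
    IsDissipativeIn J A ↔ ∀ x y, (x, y) ∈ A.graph → 0 ≤ (inner ℂ x (J y)).im := by
  rw [IsDissipativeIn, isDissipative_iff]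
  simp only [mem_graph_compPMap]
  constructor
  · exact fun h x y hxy => h x _ ⟨y, hxy, rfl⟩
  · rintro h x _ ⟨y, hxy, rfl⟩
    exact h x y hxy

/-- A dissipative operator `J A` for which `J A + iη` is onto is maximal. -/
theorem isMaximalDissipativeIn_of_surjective (hA : IsDissipativeIn J A) {η : ℝ} (hη : 0 < η)
    (hsurj : ∀ v, ∃ x y, (x, y) ∈ A.graph ∧ J y + (η * Complex.I : ℂ) • x = v) :
    IsMaximalDissipativeIn J A := by
  refine ⟨hA, fun T hle hT => ?_⟩
  have hle' := LinearPMap.le_graph_of_le hle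
  refine LinearPMap.eq_of_eq_graph (le_antisymm ?_ hle')
  rintro ⟨x, w⟩ hxw
  obtain ⟨u, y, huy, hv⟩ := hsurj (w + (η * Complex.I : ℂ) • x)
  have h1 : (u, J y) ∈ ((J : H →ₗ[ℂ] H).compPMap A).graph :=
    mem_graph_compPMap.mpr ⟨y, huy, rfl⟩
  have h2 := T.graph.sub_mem hxw (hle' h1)
  have h3 : w - J y = -((η * Complex.I : ℂ) • (x - u)) := by
    have h4 : w = J y + (η * Complex.I : ℂ) • u - (η * Complex.I : ℂ) • x := by
      rw [hv, add_sub_cancel_right]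
    nth_rewrite 1 [h4]
    rw [smul_sub]
    abel
  have h4 := isDissipative_iff.mp hT _ _ h2
  have h5 : (inner ℂ (x - u) (x - u) : ℂ) = ((‖x - u‖ ^ 2 : ℝ) : ℂ) := by
    rw [inner_self_eq_norm_sq_to_K]; push_cast; rfl
  have h6 : x - u = 0 := by
    rw [h3, inner_neg_right, inner_smul_right, h5, Complex.neg_im, Complex.im_mul_ofReal,
      Complex.im_ofReal_mul, Complex.I_im, mul_one] at h4
    have h7 : ‖x - u‖ ^ 2 ≤ 0 := by
      by_contra hcon
      push Not at hcon
      have := mul_pos hη hcon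
      linarith
    exact norm_eq_zero.mp (pow_eq_zero_iff two_ne_zero |>.mp (le_antisymm h7 (sq_nonneg _)))
  have h7 : x = u := sub_eq_zero.mp h6
  have h8 : w = J y := by
    rw [h6, smul_zero, neg_zero] at h3
    exact sub_eq_zero.mp h3
  rw [h7, h8]
  exact h1

/-- The Frobenius–Schur factorization. At `a ∈ D⁺` the point is the image of `a` under the first
column of `A`, corrected by the second column at `z - A₂₁ a`; boundedness of `R`, `F`, `G`, `S` then
extends it to all of `H⁺`. -/
theorem IsSchurData.mem_closure {μ : ℂ}
    {R : minusSpace J →L[ℂ] minusSpace J} {F : plusSpace J →L[ℂ] minusSpace J}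
    {G : minusSpace J →L[ℂ] plusSpace J} {S : plusSpace J →L[ℂ] plusSpace J}
    (h : IsSchurData J A μ R F G S)
    (hD : Dense (A.domain.comap (plusSpace J).subtype : Set (plusSpace J)))
    (a : plusSpace J) (z : minusSpace J) :
    ((a : H) + (R z - F a : minusSpace J),
      ((S a + G z : plusSpace J) : H) + (z + μ • (R z - F a) : minusSpace J)) ∈
      A.graph.topologicalClosure := by
  let f : plusSpace J → H × H := fun a => ((a : H) + (R z - F a : minusSpace J),
      ((S a + G z : plusSpace J) : H) + (z + μ • (R z - F a) : minusSpace J))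
  have hf : Continuous f := by fun_prop
  have hclosed : IsClosed (f ⁻¹' (A.graph.topologicalClosure : Set (H × H))) :=
    A.graph.isClosed_topologicalClosure.preimage hf
  refine hclosed.closure_subset_iff.mpr (fun a ha => ?_) (hD a)
  refine A.graph.le_topologicalClosure ?_
  -- on the domain, the point is assembled from the columns of the block matrix
  set w := A ⟨a, ha⟩ with hw
  have haw : ((a : H), w) ∈ A.graph := A.mem_graph ⟨a, ha⟩
  have h21 : (a, toMinus J w) ∈ (block21 J A).graph := mem_graph_block.mpr ⟨w, haw, rfl⟩
  have h11 : (a, toPlus J w) ∈ (block11 J A).graph := mem_graph_block.mpr ⟨w, haw, rfl⟩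
  have hcol : ∀ y, ((R y : H), ((G y : H) + (y + μ • R y : minusSpace J))) ∈ A.graph := fun y => by
    obtain ⟨w₁, hw₁, h22⟩ := mem_graph_block.mp (h.resolvent.mem_graph y)
    obtain ⟨w₂, hw₂, h12⟩ := mem_graph_block.mp (h.mem_G y)
    have : w₁ = w₂ := LinearPMap.mem_graph_snd_inj _ hw₁ hw₂ rfl
    subst this
    rw [h12, h22, toPlus_add_toMinus]
    exact hw₁
  have hFa : F a = R (toMinus J w) :=
    (h.eq_F _ _ ((mem_graph_opF h.resolvent).mpr ⟨_, h21, rfl⟩)).symm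
  have hSa : S a = toPlus J w - G (toMinus J w) :=
    (h.eq_S _ _ ((mem_graph_opS h.resolvent).mpr ⟨_, _, _, h11, h21, h.mem_G _, rfl⟩)).symm
  have haw' : ((a : H), (toPlus J w : H) + (toMinus J w : H)) ∈ A.graph := by
    rw [toPlus_add_toMinus]
    exact haw
  have h1 := A.graph.add_mem haw' (A.graph.sub_mem (hcol z) (hcol (toMinus J w)))
  convert! h1 using 1
  refine Prod.ext ?_ ?_
  · simp [f, hFa]
  · simp only [f, hFa, hSa, Prod.snd_add, Prod.snd_sub]
    push_cast
    simp only [smul_sub]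
    abel

end Closure

/-! ### Maximality and the invariant subspace -/

section Invariant

variable {H : Type*} [NormedAddCommGroup H] [InnerProductSpace ℂ H]
  {J : H →L[ℂ] H} {A : H →ₗ.[ℂ] H} {μ : ℂ}
  {R : minusSpace J →L[ℂ] minusSpace J} {F : plusSpace J →L[ℂ] minusSpace J}
  {G : minusSpace J →L[ℂ] plusSpace J} {S : plusSpace J →L[ℂ] plusSpace J}

theorem IsSchurData.isCompactPMap_opG (h : IsSchurData J A μ R F G S) :
    IsCompactPMap (opG J A μ) := by
  refine ⟨G, eq_of_mem_graph_iff fun y g => ?_, h.compact⟩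
  rw [mem_graph_opG h.resolvent, mem_graph_toPMap_top]
  constructor
  · exact fun hg => LinearPMap.mem_graph_snd_inj _ hg (h.mem_G y) rfl
  · rintro rfl
    exact h.mem_G y

theorem isDissipativeIn_closure (hA : IsDissipativeIn J A) (hcl : A.IsClosable) :
    IsDissipativeIn J A.closure := by
  refine isDissipativeIn_iff.mpr fun x y hxy => ?_
  rw [← hcl.graph_closure_eq_closure_graph] at hxy
  exact im_inner_nonneg_of_mem_closure J (isDissipativeIn_iff.mp hA) hxy

variable [CompleteSpace H]

/-- The inequality `Im [A u, u] ≥ 0` on the closure, written in Frobenius–Schur coordinates. -/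
theorem IsSchurData.isDissipativeData {η : ℝ} (h : IsSchurData J A (η * Complex.I) R F G S)
    (hJ : IsFundamentalSymmetry J) (hA : IsDissipativeIn J A)
    (hD : Dense (A.domain.comap (plusSpace J).subtype : Set (plusSpace J))) :
    IsDissipativeData η R F G S := by
  intro a z
  have h1 := im_inner_nonneg_of_mem_closure J (isDissipativeIn_iff.mp hA) (h.mem_closure hD a z)
  rwa [hJ.inner_apply_add] at h1

/-- The factorization solves `J A u + iη u = v` explicitly: the second component is read off from
`v`, after which the first one is obtained by inverting `S + iη`. -/
theorem IsSchurData.isMaximalDissipativeIn_closure {η : ℝ} (hη : 0 < η)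
    (h : IsSchurData J A (η * Complex.I) R F G S)
    (hJ : IsFundamentalSymmetry J) (hA : IsDissipativeIn J A) (hcl : A.IsClosable)
    (hD : Dense (A.domain.comap (plusSpace J).subtype : Set (plusSpace J))) :
    IsMaximalDissipativeIn J A.closure := by
  have := hJ.completeSpace_plusSpace
  refine isMaximalDissipativeIn_of_surjective (isDissipativeIn_closure hA hcl) hη fun v => ?_
  obtain ⟨U, hU, -⟩ := (h.isDissipativeData hJ hA hD).exists_unit hη
  set z : minusSpace J := -toMinus J v with hz
  set a : plusSpace J := (↑U⁻¹ : plusSpace J →L[ℂ] plusSpace J) (toPlus J v - G z) with ha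
  have hUa : S a + (η * Complex.I : ℂ) • a = toPlus J v - G z := by
    rw [← hU, ha]
    change (U * ↑U⁻¹ : plusSpace J →L[ℂ] plusSpace J) _ = _
    rw [U.mul_inv]
    rfl
  refine ⟨_, _, hcl.graph_closure_eq_closure_graph ▸ h.mem_closure hD a z, ?_⟩
  have h1 : S a = toPlus J v - G z - (η * Complex.I : ℂ) • a := eq_sub_of_add_eq hUa
  rw [map_add, hJ.apply_plus, hJ.apply_minus, h1, hz]
  conv_rhs => rw [← toPlus_add_toMinus J v]
  push_cast
  module

/-- The graph of an angular operator `K` with `A (a + K a) = B a + K (B a)` is an invariant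
maximal nonnegative subspace, on which `A` is similar to `B`. -/
theorem exists_invariant_subspace (hJ : IsFundamentalSymmetry J) {C : H →ₗ.[ℂ] H}
    {K : plusSpace J →L[ℂ] minusSpace J} {B : plusSpace J →L[ℂ] plusSpace J}
    (hK : ∀ a, ‖K a‖ ≤ ‖a‖)
    (hC : ∀ a : plusSpace J, ((a : H) + K a, (B a : H) + K (B a)) ∈ C.graph)
    (hB : ∀ ζ : ℂ, ζ.im < 0 → IsUnit (algebraMap ℂ (plusSpace J →L[ℂ] plusSpace J) ζ - B)) :
    ∃ (L : Submodule ℂ H) (hL : L ≤ C.domain) (T : L →L[ℂ] L),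
      IsClosed (L : Set H) ∧
      IsMaximalNonnegative J L ∧
      (∀ x : L, (T x : H) = C ⟨x, hL x.2⟩) ∧
      spectrum ℂ T ⊆ {z : ℂ | 0 ≤ z.im} := by
  let Q : H →L[ℂ] minusSpace J := toMinusL J - K ∘L toPlusL J
  let L : Submodule ℂ H := LinearMap.ker (Q : H →ₗ[ℂ] minusSpace J)
  have hmem : ∀ x, x ∈ L ↔ toMinus J x = K (toPlus J x) := fun x => sub_eq_zero
  have hLx : ∀ x ∈ L, (toPlus J x : H) + K (toPlus J x) = x := fun x hx => by
    rw [← (hmem x).mp hx, toPlus_add_toMinus]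
  have hEmem : ∀ a : plusSpace J, (a : H) + K a ∈ L := fun a => by
    rw [hmem, hJ.toMinus_add, hJ.toPlus_add]
  -- the coordinate on `L`
  let E : plusSpace J →L[ℂ] L :=
    ((plusSpace J).subtypeL + (minusSpace J).subtypeL ∘L K).codRestrict L hEmem
  let P : L →L[ℂ] plusSpace J := toPlusL J ∘L L.subtypeL
  have hPE : ∀ a, P (E a) = a := fun a => hJ.toPlus_add a (K a)
  have hEP : ∀ x, E (P x) = x := fun x => Subtype.ext (hLx x x.2)
  let T : L →L[ℂ] L := E ∘L B ∘L P
  have hgraph : ∀ x : L, ((x : H), (T x : H)) ∈ C.graph := fun x => by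
    have h1 := hC (P x)
    rwa [show ((P x : H) + K (P x)) = x from hLx x x.2] at h1
  have hL : L ≤ C.domain := fun x hx => LinearPMap.mem_domain_of_mem_graph (hgraph ⟨x, hx⟩)
  have hform : ∀ (a : plusSpace J) (b : minusSpace J),
      (inner ℂ ((a : H) + b) (J ((a : H) + b))).re = ‖a‖ ^ 2 - ‖b‖ ^ 2 := fun a b => by
    rw [hJ.inner_apply_add, Complex.sub_re]
    congr 1
    · exact inner_self_eq_norm_sq (𝕜 := ℂ) a
    · exact inner_self_eq_norm_sq (𝕜 := ℂ) b
  refine ⟨L, hL, T, Q.isClosed_ker, ⟨fun x hx => ?_, fun L' hLL' hL' => ?_⟩, fun x => ?_, ?_⟩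
  · rw [← hLx x hx, hform, sub_nonneg]
    exact pow_le_pow_left₀ (norm_nonneg _) (hK _) 2
  · refine le_antisymm (fun x hx => ?_) hLL'
    -- `x - (x₊ + K x₊)` is a nonnegative vector of the negative subspace
    set b := toMinus J x - K (toPlus J x) with hb
    have h1 : ((0 : plusSpace J) : H) + b ∈ L' := by
      have h2 := L'.sub_mem hx (hLL' (hEmem (toPlus J x)))
      convert h2 using 1
      have h3 : x - toPlus J x = toMinus J x :=
        sub_eq_iff_eq_add'.mpr (toPlus_add_toMinus J x).symm
      rw [← sub_sub, h3, hb, ZeroMemClass.coe_zero, zero_add]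
      rfl
    have h2 := hL' _ h1
    rw [hform, norm_zero] at h2
    have h3 : ‖b‖ = 0 := by nlinarith [norm_nonneg b]
    exact (hmem x).mpr (sub_eq_zero.mp (norm_eq_zero.mp h3))
  · exact (LinearPMap.mem_graph_snd_inj _ (hgraph x) (C.mem_graph ⟨x, hL x.2⟩) rfl)
  · intro ζ hζ
    by_contra hneg
    have hlt : ζ.im < 0 := not_le.mp hneg
    obtain ⟨N, hN⟩ := hB ζ hlt
    have hN1 : ∀ a, ζ • (↑N⁻¹ : plusSpace J →L[ℂ] plusSpace J) a -
        B ((↑N⁻¹ : plusSpace J →L[ℂ] plusSpace J) a) = a := fun a => by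
      change (algebraMap ℂ (plusSpace J →L[ℂ] plusSpace J) ζ - B) _ = a
      rw [← hN]
      change (N * ↑N⁻¹ : plusSpace J →L[ℂ] plusSpace J) a = a
      rw [N.mul_inv]
      rfl
    have hN2 : ∀ a, (↑N⁻¹ : plusSpace J →L[ℂ] plusSpace J) (ζ • a - B a) = a := fun a => by
      change (↑N⁻¹ : plusSpace J →L[ℂ] plusSpace J)
        ((algebraMap ℂ (plusSpace J →L[ℂ] plusSpace J) ζ - B) a) = a
      rw [← hN]
      change (↑N⁻¹ * N : plusSpace J →L[ℂ] plusSpace J) a = a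
      rw [N.inv_mul]
      rfl
    refine hζ ⟨⟨algebraMap ℂ (L →L[ℂ] L) ζ - T,
      E ∘L (↑N⁻¹ : plusSpace J →L[ℂ] plusSpace J) ∘L P, ?_, ?_⟩, rfl⟩
    · ext1 x
      change ζ • E ((↑N⁻¹ : plusSpace J →L[ℂ] plusSpace J) (P x)) -
        E (B (P (E ((↑N⁻¹ : plusSpace J →L[ℂ] plusSpace J) (P x))))) = x
      rw [hPE, ← map_smul, ← map_sub, hN1, hEP]
    · ext1 x
      change E ((↑N⁻¹ : plusSpace J →L[ℂ] plusSpace J) (P (ζ • x - E (B (P x))))) = x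
      rw [map_sub, map_smul, hPE, hN2, hEP]

end Invariant

end Krein

theorem mainTheorem1 {H : Type*} [NormedAddCommGroup H] [InnerProductSpace ℂ H] [CompleteSpace H]
    [TopologicalSpace.SeparableSpace H]
    (J : H →L[ℂ] H) (hJ : Krein.IsFundamentalSymmetry J)
    (A : H →ₗ.[ℂ] H) (hA : Krein.IsDissipativeIn J A)
    (hdom : A.domain =
      (A.domain ⊓ Krein.plusSpace J) ⊔ (A.domain ⊓ Krein.minusSpace J))
    (hdense : Dense (A.domain : Set H))
    (h_i : Krein.IsMaximalDissipative (-Krein.block22 J A))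
    (h_ii : ∃ μ : ℂ, 0 < μ.im ∧ Krein.HasBoundedClosure (Krein.opF J A μ))
    (h_iii : ∃ μ : ℂ, 0 < μ.im ∧ Krein.IsCompactPMap (Krein.opG J A μ))
    (h_iv : ∃ μ : ℂ, 0 < μ.im ∧ Krein.HasBoundedClosure (Krein.opS J A μ)) :
    (∀ μ : ℂ, 0 < μ.im →
      Krein.IsResolventPoint (Krein.block22 J A) μ ∧
      Krein.HasBoundedClosure (Krein.opF J A μ) ∧
      Krein.IsCompactPMap (Krein.opG J A μ) ∧
      Krein.HasBoundedClosure (Krein.opS J A μ)) ∧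
    A.IsClosable ∧
    Krein.IsMaximalDissipativeIn J A.closure ∧
    ∃ (L : Submodule ℂ H) (hL : L ≤ A.closure.domain) (T : L →L[ℂ] L),
      IsClosed (L : Set H) ∧
      Krein.IsMaximalNonnegative J L ∧
      (∀ x : L, (T x : H) = A.closure ⟨x, hL x.2⟩) ∧
      spectrum ℂ T ⊆ {z : ℂ | 0 ≤ z.im} := by
  obtain ⟨hall, η, R, F, G, S, hη, h, hGn, hSn⟩ :=
    Krein.exists_isSchurData hJ hdom hdense h_i h_ii h_iii h_iv
  have hD := Krein.dense_comap_plusSpace hJ hdom hdense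
  have hcl : A.IsClosable :=
    Krein.isClosable_of_dissipative J hJ.injective (Krein.isDissipativeIn_iff.mp hA) hdense
  refine ⟨fun μ hμ => ?_, hcl, h.isMaximalDissipativeIn_closure hη hJ hA hcl hD, ?_⟩
  · obtain ⟨R, F, G, S, h⟩ := hall μ hμ
    exact ⟨h.resolvent.isResolventPoint, Krein.hasBoundedClosure_of_extension F h.eq_F,
      h.isCompactPMap_opG, Krein.hasBoundedClosure_of_extension S h.eq_S⟩
  · have := hJ.completeSpace_plusSpace
    have := hJ.completeSpace_minusSpace
    obtain ⟨K, B, hK, hKB, hB⟩ :=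
      (h.isDissipativeData hJ hA hD).exists_angular hη h.compact hGn hSn
    refine Krein.exists_invariant_subspace hJ hK (fun a => ?_) hB
    obtain ⟨z, hKa, hBa, hKBa⟩ := hKB a
    have h1 := h.mem_closure hD a z
    rwa [← hKa, ← hBa, ← hKBa, hcl.graph_closure_eq_closure_graph] at h1
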